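/- All graphs are finite and simple. For a graph $G$ and $T\subseteq V(G)$ let $c_G(T)$ be the number of connected components of $G\setminus T$; $T$ is a cutset if $c_G(T\setminus\{v\})<c_G(T)$ for every $v\in T$, and $v$ is a cutpoint of $G$ if $\{v\}$ is a cutset. A block is a connected graph without cutpoints. Let $\mathbb K$ be a field. The binomial edge ideal $J_G\subseteq S=\mathbb K[x_v,y_v : v\in V(G)]$ is generated by the binomials $x_iy_j-x_jy_i$ with $\{i,j\}\in E(G)$. An ideal $I\subseteq S$ is unmixed if all associated primes of $S/I$ have the same height. Let $r\ge 1$ and let $B$ be a chain of cycles: a block of cycle rank $|E(B)|-|V(B)|+1=r$ such that $B=\bigcup_{i=1}^r D_i$, where the $D_i$ are cycles, $E(D_i)\cap E(D_{i+1})$ is the edge set of a path (of positive length) for $1\le i<r$, and $E(D_i)\cap E(D_j)=\emptyset$ whenever $|i-j|\ge 2$. Let $W\subseteq V(B)$, and let $\overline B$ be the block with whiskers obtained from $B$ by adding, for each $w\in W$, a new vertex $f_w$ and the edge $\{w,f_w\}$. Assume that there are vertices $w_i,u_i$ of $B$ such that the following hold, where "cutpoint" means cutpoint of $\overline B$ and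 $\deg$ is the degree in $\overline B$: 1. each $D_i$ is a cycle $C_3$ or $C_4$; 2. if $D_i=C_4$ and $i<r$, then $D_{i+1}=C_3$; 3. for $1\le i\le r-1$, $E(D_i)\cap E(D_{i+1})=\{\{w_i,u_i\}\}$, where $w_i$ is a cutpoint and $u_i$ is not a cutpoint; 4. for $1\le i\le r-2$, $\{w_i,w_{i+1}\}\in E(D_{i+1})$ or $w_i=w_{i+1}$, and $\{u_i,u_{i+1}\}\in E(D_{i+1})$ or $u_i=u_{i+1}$; 5. if $D_1=C_4$, then $V(D_1)=\{w_0,w_1,u_0,u_1\}$ with $\{w_0,w_1\},\{u_0,u_1\}\in E(D_1)$, the vertices $w_0,w_1$ are cutpoints, and $u_0,u_1$ are not cutpoints; 6. if $D_r=C_4$, then $V(D_r)=\{w_{r-1},w_r,u_{r-1},u_r\}$ with $\{w_{r-1},w_r\},\{u_{r-1},u_r\}\in E(D_r)$, the vertices $w_{r-1},w_r$ are cutpoints, and $u_{r-1},u_r$ are not cutpoints; 7. every $v\in V(B)$ with $\deg v\ge 5$, or with $\deg v\ge 4$ and $v$ a vertex of some $D_i=C_4$, is a cutpoint. Then $J_{\overline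 B}$ is unmixed. -/

import Mathlib

/-! ### Cutsets, cutpoints, blocks, cycle rank -/

namespace SimpleGraph

variable {V : Type*}

/-- `c_G(T)`: the number of connected components of `G \ T`, the induced subgraph of `G` on the
complement of `T`. -/
noncomputable def numComponentsOff (G : SimpleGraph V) (T : Set V) : ℕ :=
  Nat.card (G.induce Tᶜ).ConnectedComponent

/-- `T` is a cutset of `G` if `c_G(T \ {v}) < c_G(T)` for each `v ∈ T`. -/
def IsCutset (G : SimpleGraph V) (T : Set V) : Prop :=
  ∀ v ∈ T, G.numComponentsOff (T \ {v}) < G.numComponentsOff T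

/-- A vertex `v` is a cutpoint of `G` if `{v}` is a cutset of `G`. -/
def IsCutpoint (G : SimpleGraph V) (v : V) : Prop :=
  G.IsCutset {v}

/-- A graph which is itself a block: it is connected and has no cutpoint. -/
def IsBlockGraph (G : SimpleGraph V) : Prop :=
  G.Connected ∧ ∀ v, ¬ G.IsCutpoint v

/-- The cycle rank `m(G) = |E(G)| - |V(G)| + 1` of a (finite, connected) graph, as an integer. -/
noncomputable def cycleRank (G : SimpleGraph V) : ℤ :=
  (G.edgeSet.ncard : ℤ) - (Nat.card V : ℤ) + 1

/-- The graph obtained from `G` by attaching one whisker `{w, f_w}` to every `w ∈ W`.  Its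
vertices are the vertices of `G` (`Sum.inl v`) and one new vertex `f_w` (`Sum.inr w`) for each
`w ∈ W`.  If `G` is a block, this is the block with whiskers on `W`. -/
def addWhiskers (G : SimpleGraph V) (W : Set V) : SimpleGraph (V ⊕ W) :=
  SimpleGraph.fromRel fun a b =>
    match a, b with
    | Sum.inl v, Sum.inl v' => G.Adj v v'
    | Sum.inl v, Sum.inr w => v = w
    | _, _ => False

/-- The subgraph `D` is a cycle `C_n` (`n ≥ 3`). -/
def Subgraph.IsCycleGraph {G : SimpleGraph V} (D : G.Subgraph) (n : ℕ) : Prop :=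
  3 ≤ n ∧ Nonempty (D.coe ≃g SimpleGraph.cycleGraph n)

/-! ### Chains of cycles -/

/-- `B = D_1 ∪ ⋯ ∪ D_r` is a chain of cycles: `B` is a block of cycle rank `r`, the `D_i` are
cycles, the common edges of two consecutive cycles are the edges of a path, and
non-consecutive cycles have no common edge.  Only the values `D i` with `1 ≤ i ≤ r` matter. -/
structure IsChainOfCycles (B : SimpleGraph V) (r : ℕ) (D : ℕ → B.Subgraph) : Prop where
  one_le : 1 ≤ r
  block : B.IsBlockGraph
  cycleRank_eq : B.cycleRank = r
  cycles : ∀ i, 1 ≤ i → i ≤ r → ∃ n, (D i).IsCycleGraph n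
  union_eq : ⨆ i ∈ Set.Icc 1 r, D i = ⊤
  consecutive : ∀ i, 1 ≤ i → i + 1 ≤ r → ∃ (a b : V) (p : B.Walk a b),
    p.IsPath ∧ 0 < p.length ∧ (D i).edgeSet ∩ (D (i + 1)).edgeSet = {e | e ∈ p.edges}
  nonconsecutive : ∀ i j, 1 ≤ i → i + 1 < j → j ≤ r → (D i).edgeSet ∩ (D j).edgeSet = ∅

/-- The whiskered chain of cycles `addWhiskers B W`, where `B = D_1 ∪ ⋯ ∪ D_r`, together with a
labelling `w_i, u_i` of vertices of `B` satisfying the prescribed cutpoint pattern.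
Cutpoints and degrees are those of the whiskered graph. -/
structure IsChainSetup (B : SimpleGraph V) (W : Set V) (r : ℕ) (D : ℕ → B.Subgraph)
    (w u : ℕ → V) : Prop where
  chain : B.IsChainOfCycles r D
  three_or_four : ∀ i, 1 ≤ i → i ≤ r → (D i).IsCycleGraph 3 ∨ (D i).IsCycleGraph 4
  four_then_three : ∀ i, 1 ≤ i → i + 1 ≤ r → (D i).IsCycleGraph 4 → (D (i + 1)).IsCycleGraph 3
  inter_eq : ∀ i, 1 ≤ i → i + 1 ≤ r →
    (D i).edgeSet ∩ (D (i + 1)).edgeSet = {s(w i, u i)} ∧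
    (B.addWhiskers W).IsCutpoint (Sum.inl (w i)) ∧
    ¬ (B.addWhiskers W).IsCutpoint (Sum.inl (u i))
  next_label : ∀ i, 1 ≤ i → i + 2 ≤ r →
    ((D (i + 1)).Adj (w i) (w (i + 1)) ∨ w i = w (i + 1)) ∧
    ((D (i + 1)).Adj (u i) (u (i + 1)) ∨ u i = u (i + 1))
  first_four : (D 1).IsCycleGraph 4 →
    (D 1).verts = {w 0, w 1, u 0, u 1} ∧
    (D 1).Adj (w 0) (w 1) ∧ (D 1).Adj (u 0) (u 1) ∧
    (B.addWhiskers W).IsCutpoint (Sum.inl (w 0)) ∧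
    (B.addWhiskers W).IsCutpoint (Sum.inl (w 1)) ∧
    ¬ (B.addWhiskers W).IsCutpoint (Sum.inl (u 0)) ∧
    ¬ (B.addWhiskers W).IsCutpoint (Sum.inl (u 1))
  last_four : (D r).IsCycleGraph 4 →
    (D r).verts = {w (r - 1), w r, u (r - 1), u r} ∧
    (D r).Adj (w (r - 1)) (w r) ∧ (D r).Adj (u (r - 1)) (u r) ∧
    (B.addWhiskers W).IsCutpoint (Sum.inl (w (r - 1))) ∧
    (B.addWhiskers W).IsCutpoint (Sum.inl (w r)) ∧
    ¬ (B.addWhiskers W).IsCutpoint (Sum.inl (u (r - 1))) ∧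
    ¬ (B.addWhiskers W).IsCutpoint (Sum.inl (u r))
  high_degree : ∀ v : V,
    (5 ≤ ((B.addWhiskers W).neighborSet (Sum.inl v)).ncard ∨
      (4 ≤ ((B.addWhiskers W).neighborSet (Sum.inl v)).ncard ∧
        ∃ i, 1 ≤ i ∧ i ≤ r ∧ (D i).IsCycleGraph 4 ∧ v ∈ (D i).verts)) →
    (B.addWhiskers W).IsCutpoint (Sum.inl v)

/-! ### Binomial edge ideals -/

/-- The binomial edge ideal `J_G` in `K[x_v, y_v : v ∈ V]`, generated by the binomials
`x_i y_j - x_j y_i` for the edges `{i, j}` of `G`.  Here `x_v = X (Sum.inl v)` and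
`y_v = X (Sum.inr v)`; the two orders of an edge give generators that differ by a sign. -/
noncomputable def binomialEdgeIdeal (K : Type*) [Field K] (G : SimpleGraph V) :
    Ideal (MvPolynomial (V ⊕ V) K) :=
  Ideal.span {f | ∃ i j, G.Adj i j ∧
    f = MvPolynomial.X (Sum.inl i) * MvPolynomial.X (Sum.inr j) -
      MvPolynomial.X (Sum.inl j) * MvPolynomial.X (Sum.inr i)}

end SimpleGraph

/-- An ideal `I` of a (Noetherian) ring `R` is unmixed if all associated primes of `R ⧸ I` have
the same height. -/
def Ideal.IsUnmixed {R : Type*} [CommRing R] (I : Ideal R) : Prop :=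
  ∀ P ∈ associatedPrimes R (R ⧸ I), ∀ Q ∈ associatedPrimes R (R ⧸ I), P.height = Q.height

/-! ### Toric parametrizations and their kernels -/

namespace SimpleGraph

variable {V : Type*}

/-! For T ⊆ V let P_T be the kernel of the map sending x_v, y_v to 0 for v ∈ T, and to a_k z_v, b_k
z_v for v in the component k of G \ T (`toricHom`). It contains the variables over T and the
2-minors within each component. Three facts reduce unmixedness to a count of components: (1) J_G is
the intersection of the P_T (`mem_binomialEdgeIdeal_of_forall`), hence radical, so its associated
primes are minimal. (2) A minimal prime is P_T for some T each of whose vertices has neighbours in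
two components of G \ T (`exists_eq_ker_toricHom`). (3) P_T has height |V| + |T| - c_G(T)
(`IsRepFun.height_eq`, `ncard_heightIndex_add`). So it suffices that c_G(T) = |T| + 1 for T as in
(2). As `isolate` keeps the vertices of T as isolated points, this reads 2|T| + 1 components.

In a block with whiskers such a T contains no leaf. Its vertices are removed one at a time, those in
W first; W is exactly the set of cutpoints lying in B. Removing a whiskered vertex splits off its
leaf and leaves the rest of B connected, since the u-vertices of gates and squares survive
(`IsChainSetup.reachable_isolate`). Removing v ∉ W has to split one component into exactly two. By
`IsChainSetup.hasLinkPath` the neighbours of v lie on a path with at most four vertices, whose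
interior vertices are in W and each separate, together with v, the two sides of the path. Hence two
neighbours separated by T are already separated by v and T ∩ W, and any other neighbour is adjacent
to one of the two. The conditions on squares and degrees keep this path short.

The separators are the gates {w_j, u_j} and the diagonals of squares. That the cycles before a gate
meet those after it only in the gate follows from the cycle rank (`IsChainSetup.inter_verts_eq`). -/

/-- The binomial `x_i y_j - x_j y_i`. -/
noncomputable def edgeMinor (K : Type*) [Field K] (i j : V) : MvPolynomial (V ⊕ V) K :=
  MvPolynomial.X (Sum.inl i) * MvPolynomial.X (Sum.inr j) -
    MvPolynomial.X (Sum.inl j) * MvPolynomial.X (Sum.inr i)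

lemma edgeMinor_self (K : Type*) [Field K] (i : V) : edgeMinor K i i = 0 := by
  simp [edgeMinor]

open Classical in
/-- The parametrization `x_v ↦ a_{c v} z_v` (or `0` if `v ∈ A`) and `y_v ↦ b_{c v} z_v`
(or `0` if `v ∈ C`). -/
noncomputable def toricHom (K : Type*) [Field K] (A C : Set V) (c : V → V) :
    MvPolynomial (V ⊕ V) K →ₐ[K] MvPolynomial (Fin 3 × V) K :=
  MvPolynomial.aeval (Sum.elim
    (fun v => if v ∈ A then 0 else MvPolynomial.X (0, c v) * MvPolynomial.X (2, v))
    (fun v => if v ∈ C then 0 else MvPolynomial.X (1, c v) * MvPolynomial.X (2, v)))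

section toricHom

variable {K : Type*} [Field K] {A C : Set V} {c : V → V}

open Classical in
lemma toricHom_X_inl (v : V) : toricHom K A C c (MvPolynomial.X (Sum.inl v)) =
    if v ∈ A then 0 else MvPolynomial.X (0, c v) * MvPolynomial.X (2, v) := by
  simp [toricHom]

open Classical in
lemma toricHom_X_inr (v : V) : toricHom K A C c (MvPolynomial.X (Sum.inr v)) =
    if v ∈ C then 0 else MvPolynomial.X (1, c v) * MvPolynomial.X (2, v) := by
  simp [toricHom]

instance isPrime_ker_toricHom : (RingHom.ker (toricHom K A C c)).IsPrime :=
  RingHom.ker_isPrime _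

lemma X_inl_mem_ker_toricHom {v : V} :
    MvPolynomial.X (Sum.inl v) ∈ RingHom.ker (toricHom K A C c) ↔ v ∈ A := by
  rw [RingHom.mem_ker, toricHom_X_inl]
  split_ifs with h <;> simp [h, MvPolynomial.X_ne_zero]

lemma X_inr_mem_ker_toricHom {v : V} :
    MvPolynomial.X (Sum.inr v) ∈ RingHom.ker (toricHom K A C c) ↔ v ∈ C := by
  rw [RingHom.mem_ker, toricHom_X_inr]
  split_ifs with h <;> simp [h, MvPolynomial.X_ne_zero]

lemma edgeMinor_mem_ker_toricHom {v w : V} (hc : c v = c w)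
    (hvw : v ≠ w → v ∉ A ∧ v ∉ C ∧ w ∉ A ∧ w ∉ C) :
    edgeMinor K v w ∈ RingHom.ker (toricHom K A C c) := by
  by_cases h : v = w
  · subst h
    simp [edgeMinor_self]
  · obtain ⟨h1, h2, h3, h4⟩ := hvw h
    rw [RingHom.mem_ker, edgeMinor]
    simp only [map_sub, map_mul, toricHom_X_inl, toricHom_X_inr, h1, h2, h3, h4, if_false, hc]
    ring

lemma edgeMinor_notMem_ker_toricHom {v w : V} (hc : c v ≠ c w) (h1 : v ∉ A) (h4 : w ∉ C) :
    edgeMinor K v w ∉ RingHom.ker (toricHom K A C c) := by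
  classical
  intro h
  rw [RingHom.mem_ker, edgeMinor] at h
  simp only [map_sub, map_mul, toricHom_X_inl, toricHom_X_inr, h1, h4, if_false] at h
  -- Evaluation at a_{c v} = b_{c w} = 1, all z equal to 1 and every other variable 0: the first
  -- product becomes 1, the second 0.
  have := congrArg (MvPolynomial.eval (fun p : Fin 3 × V =>
    if p = (0, c v) ∨ p = (1, c w) ∨ p.1 = 2 then (1 : K) else 0)) h
  split_ifs at this <;> simp [hc, hc.symm] at this

/-- A prime containing the evident elements of the kernel contains the kernel. -/
theorem ker_toricHom_le {P : Ideal (MvPolynomial (V ⊕ V) K)} [P.IsPrime]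
    (hA : ∀ v ∈ A, MvPolynomial.X (Sum.inl v) ∈ P)
    (hC : ∀ v ∈ C, MvPolynomial.X (Sum.inr v) ∈ P)
    (hm : ∀ v w, c v = c w → edgeMinor K v w ∈ P) :
    RingHom.ker (toricHom K A C c) ≤ P := by
  classical
  let F := FractionRing (MvPolynomial (V ⊕ V) K ⧸ P)
  let π : MvPolynomial (V ⊕ V) K →+* F :=
    (algebraMap (MvPolynomial (V ⊕ V) K ⧸ P) F).comp (Ideal.Quotient.mk P)
  have hπ : ∀ f, π f = 0 ↔ f ∈ P := fun f => by
    rw [← Ideal.Quotient.eq_zero_iff_mem]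
    exact (map_eq_zero_iff _ (IsFractionRing.injective (MvPolynomial (V ⊕ V) K ⧸ P) F))
  have hprop : ∀ v w, c v = c w → π (MvPolynomial.X (Sum.inl v)) * π (MvPolynomial.X (Sum.inr w))
      = π (MvPolynomial.X (Sum.inl w)) * π (MvPolynomial.X (Sum.inr v)) := fun v w h => by
    have := (hπ _).2 (hm v w h)
    rw [edgeMinor, map_sub, map_mul, map_mul] at this
    exact sub_eq_zero.1 this
  -- Over the fraction field of the quotient by P, the vectors (x_v, y_v) of one class are pairwise
  -- proportional, hence multiples of a single (a, b); if all x_v vanish, (0, 1) serves. These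
  -- values define `ψ`, and `π` factors through the parametrization.
  have key : ∀ k : V, ∃ a b : F, ∀ v, c v = k → ∃ z : F,
      π (MvPolynomial.X (Sum.inl v)) = a * z ∧ π (MvPolynomial.X (Sum.inr v)) = b * z := by
    intro k
    by_cases h : ∃ v, c v = k ∧ π (MvPolynomial.X (Sum.inl v)) ≠ 0
    · obtain ⟨v₀, hv₀, hne⟩ := h
      refine ⟨π (MvPolynomial.X (Sum.inl v₀)), π (MvPolynomial.X (Sum.inr v₀)), fun v hv =>
        ⟨π (MvPolynomial.X (Sum.inl v)) / π (MvPolynomial.X (Sum.inl v₀)), ?_, ?_⟩⟩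
      · rw [← mul_div_assoc, mul_div_cancel_left₀ _ hne]
      · rw [← mul_div_assoc, eq_div_iff hne]
        linear_combination -(hprop v v₀ (hv.trans hv₀.symm))
    · push Not at h
      exact ⟨0, 1, fun v hv => ⟨π (MvPolynomial.X (Sum.inr v)), by simp [h v hv], by simp⟩⟩
  choose a b z hx hy using key
  let ψ : MvPolynomial (Fin 3 × V) K →+* F := MvPolynomial.eval₂Hom (π.comp MvPolynomial.C)
    (fun p => ![a p.2, b p.2, z (c p.2) p.2 rfl] p.1)
  have hψ : ψ.comp (toricHom K A C c : MvPolynomial (V ⊕ V) K →+* _) = π := by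
    apply MvPolynomial.ringHom_ext
    · intro r
      have h : toricHom K A C c (MvPolynomial.C r) = MvPolynomial.C r :=
        (toricHom K A C c).commutes r
      simp only [RingHom.comp_apply, RingHom.coe_coe, h, ψ, MvPolynomial.coe_eval₂Hom,
        MvPolynomial.eval₂_C]
    · rintro (v | v)
      · simp only [RingHom.comp_apply, RingHom.coe_coe, toricHom_X_inl]
        split_ifs with h
        · rw [map_zero, (hπ _).2 (hA v h)]
        · simp [ψ, hx (c v) v rfl]
      · simp only [RingHom.comp_apply, RingHom.coe_coe, toricHom_X_inr]
        split_ifs with h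
        · rw [map_zero, (hπ _).2 (hC v h)]
        · simp [ψ, hy (c v) v rfl]
  intro f hf
  rw [← hπ, ← hψ, RingHom.comp_apply]
  have : toricHom K A C c f = 0 := hf
  simp [this]

/-! ### The height of the kernel -/

/-- Index set of a generating set, up to radical near the prime, of the kernel. -/
def heightIndex (T : Set V) (c : V → V) : Set (V ⊕ V) :=
  {e | Sum.elim (fun v => v ∈ T ∨ c v ≠ v) (fun v => v ∈ T) e}

variable {T : Set V}

/-- `c` picks a representative of each class of a partition in which every element of `T` is
alone. -/
structure IsRepFun (T : Set V) (c : V → V) : Prop where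
  idem : ∀ v, c (c v) = c v
  alone : ∀ v w, c v = c w → v ∈ T → v = w

lemma IsRepFun.fix (h : IsRepFun T c) {v : V} (hv : v ∈ T) : c v = v :=
  (h.alone v (c v) (h.idem v).symm hv).symm

lemma IsRepFun.notMem (h : IsRepFun T c) {v : V} (hv : c v ≠ v) : v ∉ T ∧ c v ∉ T :=
  ⟨fun h' => hv (h.fix h'), fun h' => hv (h.alone _ _ (h.idem v) h')⟩

lemma IsRepFun.edgeMinor_mem (h : IsRepFun T c) {v w : V} (hc : c v = c w) :
    edgeMinor K v w ∈ RingHom.ker (toricHom K T T c) :=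
  edgeMinor_mem_ker_toricHom hc fun hne =>
    ⟨fun h' => hne (h.alone _ _ hc h'), fun h' => hne (h.alone _ _ hc h'),
      fun h' => hne (h.alone _ _ hc.symm h').symm, fun h' => hne (h.alone _ _ hc.symm h').symm⟩

/-- Krull's height theorem: the kernel is minimal over an ideal with one generator per index, namely
the variables over T and the minor of each remaining v with its representative. -/
lemma IsRepFun.height_le [Finite V] (h : IsRepFun T c) :
    (RingHom.ker (toricHom K T T c)).height ≤ (heightIndex T c).ncard := by
  classical
  let g : V ⊕ V → MvPolynomial (V ⊕ V) K := Sum.elim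
    (fun v => if v ∈ T then MvPolynomial.X (Sum.inl v) else edgeMinor K v (c v))
    (fun v => MvPolynomial.X (Sum.inr v))
  have hmin : RingHom.ker (toricHom K T T c) ∈
      (Ideal.span (g '' heightIndex T c)).minimalPrimes := by
    refine ⟨⟨inferInstance, ?_⟩, ?_⟩
    · rw [Ideal.span_le]
      rintro _ ⟨v | v, hv, rfl⟩
      · by_cases hT : v ∈ T
        · simpa [g, hT] using X_inl_mem_ker_toricHom.2 hT
        · simpa [g, hT] using h.edgeMinor_mem (K := K) (h.idem v).symm
      · exact X_inr_mem_ker_toricHom.2 hv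
    · rintro Q ⟨hQ, hsQ⟩ hQP
      rw [Ideal.span_le] at hsQ
      have hgm : ∀ v, edgeMinor K v (c v) ∈ Q := fun v => by
        by_cases hv : c v = v
        · rw [hv, edgeMinor_self]
          exact Q.zero_mem
        · simpa [g, (h.notMem hv).1] using
            hsQ ⟨Sum.inl v, Or.inr hv, rfl⟩
      refine ker_toricHom_le (fun v hv => ?_) (fun v hv => ?_) (fun v w hvw => ?_)
      · simpa [g, hv] using hsQ ⟨Sum.inl v, Or.inl hv, rfl⟩
      · exact hsQ ⟨Sum.inr v, hv, rfl⟩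
      · by_cases hne : v = w
        · rw [hne, edgeMinor_self]
          exact Q.zero_mem
        have hr : c v ∉ T := fun hT => by
          have h1 := h.alone _ v (h.idem v) hT
          have h2 := h.alone _ w ((h.idem v).trans hvw) hT
          exact hne (h1.symm.trans h2)
        -- The generators compare vertices only with their representative s = c v. The identity
        -- x_s[v,w] = x_w[v,s] - x_v[w,s] gives the other minors once x_s ∉ Q, which holds because Q
        -- lies inside the toric prime.
        have hxr : MvPolynomial.X (Sum.inl (c v)) ∉ Q := fun hx =>
          hr (X_inl_mem_ker_toricHom.1 (hQP hx))
        refine (hQ.mem_or_mem (?_ : MvPolynomial.X (Sum.inl (c v)) * _ ∈ Q)).resolve_left hxr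
        have h1 := Q.mul_mem_left (MvPolynomial.X (Sum.inl w)) (hgm v)
        have h2 := Q.mul_mem_left (MvPolynomial.X (Sum.inl v)) (hgm w)
        rw [← hvw] at h2
        have h3 := Q.sub_mem h1 h2
        convert h3 using 1
        simp only [edgeMinor]
        ring
  refine (Ideal.height_le_card_of_mem_minimalPrimes_span
    ((Set.toFinite _).image g) hmin).trans ?_
  exact_mod_cast Set.ncard_image_le (Set.toFinite _)

open Classical in
/-- The partition obtained by merging with their representatives only the vertices `v` with
`Sum.inl v ∈ F`. -/
noncomputable def partialRep (c : V → V) (F : Set (V ⊕ V)) (v : V) : V :=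
  if Sum.inl v ∈ F then c v else v

/-- The prime obtained by imposing only the relations indexed by `F`. -/
noncomputable def partialPrime (K : Type*) [Field K] (T : Set V) (c : V → V)
    (F : Set (V ⊕ V)) : Ideal (MvPolynomial (V ⊕ V) K) :=
  RingHom.ker (toricHom K {v ∈ T | Sum.inl v ∈ F} {v ∈ T | Sum.inr v ∈ F} (partialRep c F))

instance isPrime_partialPrime (F : Set (V ⊕ V)) : (partialPrime K T c F).IsPrime :=
  isPrime_ker_toricHom

lemma IsRepFun.comp_partialRep (h : IsRepFun T c) {F F' : Set (V ⊕ V)} (hF : F ⊆ F') (v : V) :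
    partialRep c F' (partialRep c F v) = partialRep c F' v := by
  by_cases h1 : Sum.inl v ∈ F
  · by_cases h2 : Sum.inl (c v) ∈ F' <;> simp [partialRep, h1, hF h1, h2, h.idem]
  · rw [show partialRep c F v = v from if_neg h1]

lemma IsRepFun.edgeMinor_mem_partialPrime (h : IsRepFun T c) {F : Set (V ⊕ V)} {v w : V}
    (hvw : partialRep c F v = partialRep c F w) : edgeMinor K v w ∈ partialPrime K T c F := by
  refine edgeMinor_mem_ker_toricHom hvw fun hne => ?_
  have hc : c v = c w := by
    have := congrArg (partialRep c Set.univ) hvw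
    rw [h.comp_partialRep (Set.subset_univ _), h.comp_partialRep (Set.subset_univ _)] at this
    simpa [partialRep] using this
  have h1 : v ∉ T := fun h' => hne (h.alone _ _ hc h')
  have h2 : w ∉ T := fun h' => hne (h.alone _ _ hc.symm h').symm
  exact ⟨fun h' => h1 h'.1, fun h' => h1 h'.1, fun h' => h2 h'.1, fun h' => h2 h'.1⟩

lemma IsRepFun.partialPrime_mono (h : IsRepFun T c) {F F' : Set (V ⊕ V)} (hF : F ⊆ F') :
    partialPrime K T c F ≤ partialPrime K T c F' := by
  refine ker_toricHom_le (fun v hv => ?_) (fun v hv => ?_) (fun v w hvw => ?_)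
  · exact X_inl_mem_ker_toricHom.2 ⟨hv.1, hF hv.2⟩
  · exact X_inr_mem_ker_toricHom.2 ⟨hv.1, hF hv.2⟩
  · refine h.edgeMinor_mem_partialPrime ?_
    rw [← h.comp_partialRep hF v, hvw, h.comp_partialRep hF]

/-- The new relation is itself the witness: a variable if v ∈ T, otherwise the minor of v and c v,
which were in different classes before the merge. -/
lemma IsRepFun.partialPrime_lt (h : IsRepFun T c) {F : Set (V ⊕ V)} {e : V ⊕ V}
    (he : e ∈ heightIndex T c) (heF : e ∉ F) :
    partialPrime K T c F < partialPrime K T c (insert e F) := by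
  refine lt_of_le_not_ge (h.partialPrime_mono (Set.subset_insert _ _)) fun hle => ?_
  rcases e with v | v
  · by_cases hv : v ∈ T
    · exact heF (X_inl_mem_ker_toricHom.1
        (hle (X_inl_mem_ker_toricHom.2 ⟨hv, Set.mem_insert _ _⟩))).2
    · have hc : c v ≠ v := he.resolve_left hv
      refine edgeMinor_notMem_ker_toricHom (v := v) (w := c v) ?_ (fun h' => hv h'.1)
        (fun h' => (h.notMem hc).2 h'.1) (hle (h.edgeMinor_mem_partialPrime ?_))
      · by_cases h2 : Sum.inl (c v) ∈ F <;> simpa [partialRep, heF, h2, h.idem] using hc.symm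
      · simp [partialRep, h.idem]
  · exact heF (X_inr_mem_ker_toricHom.1
      (hle (X_inr_mem_ker_toricHom.2 ⟨he, Set.mem_insert _ _⟩))).2

/-- Imposing the relations one at a time gives a strict chain of primes. -/
lemma IsRepFun.card_le_height_partialPrime (h : IsRepFun T c) (F : Finset (V ⊕ V))
    (hF : (F : Set (V ⊕ V)) ⊆ heightIndex T c) :
    (F.card : ℕ∞) ≤ (partialPrime K T c F).height := by
  classical
  induction F using Finset.induction_on with
  | empty => simp
  | insert e F he ih =>
    rw [Finset.coe_insert, Set.insert_subset_iff] at hF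
    rw [Finset.card_insert_of_notMem he, Finset.coe_insert]
    have h1 := Ideal.height_add_one_le_of_lt_of_isPrime
      (h.partialPrime_lt (K := K) hF.1 (F := F) (by simpa using he))
    push_cast
    exact (add_le_add_left (ih hF.2) 1).trans h1

lemma partialPrime_heightIndex :
    partialPrime K T c (heightIndex T c) = RingHom.ker (toricHom K T T c) := by
  have h1 : {v ∈ T | Sum.inl v ∈ heightIndex T c} = T := by
    ext v
    simp +contextual [heightIndex]
  have h2 : {v ∈ T | Sum.inr v ∈ heightIndex T c} = T := by
    ext v
    simp [heightIndex]
  have h3 : partialRep c (heightIndex T c) = c := by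
    ext v
    unfold partialRep
    split_ifs with hv
    · rfl
    · by_contra h'
      exact hv (Or.inr (Ne.symm h'))
  rw [partialPrime, h1, h2, h3]

/-- The height of the kernel of a toric parametrization. -/
theorem IsRepFun.height_eq [Finite V] (h : IsRepFun T c) :
    (RingHom.ker (toricHom K T T c)).height = (heightIndex T c).ncard := by
  refine le_antisymm h.height_le ?_
  have h1 := h.card_le_height_partialPrime (K := K) (Set.toFinite (heightIndex T c)).toFinset
    (by simp)
  rwa [Set.Finite.coe_toFinset, partialPrime_heightIndex,
    ← Set.ncard_eq_toFinset_card _ (Set.toFinite _)] at h1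

end toricHom

end SimpleGraph

/-! ### Isolating a set of vertices -/

namespace SimpleGraph

variable {V : Type*}

/-- The graph obtained from `G` by deleting the edges which meet `T`. -/
def isolate (G : SimpleGraph V) (T : Set V) : SimpleGraph V where
  Adj a b := G.Adj a b ∧ a ∉ T ∧ b ∉ T
  symm := ⟨fun _ _ h => ⟨h.1.symm, h.2.2, h.2.1⟩⟩
  loopless := ⟨fun _ h => G.irrefl h.1⟩

variable {G : SimpleGraph V} {T : Set V}

lemma isolate_le : G.isolate T ≤ G := fun _ _ h => h.1

lemma isolate_anti {T' : Set V} (h : T ⊆ T') : G.isolate T' ≤ G.isolate T :=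
  fun _ _ h' => ⟨h'.1, fun h1 => h'.2.1 (h h1), fun h1 => h'.2.2 (h h1)⟩

/-- A predicate closed under adjacency is closed under reachability. -/
lemma Reachable.closed {H : SimpleGraph V} {P : V → Prop} (hP : ∀ x y, H.Adj x y → P x → P y)
    {a b : V} (h : H.Reachable a b) (ha : P a) : P b := by
  obtain ⟨p⟩ := h
  induction p with
  | nil => exact ha
  | cons hadj _ ih => exact ih (hP _ _ hadj ha)

lemma eq_of_reachable_isolate {a b : V} (h : (G.isolate T).Reachable a b) (ha : a ∈ T) :
    a = b :=
  h.closed (P := fun x => a = x) (fun x y (hadj : (G.isolate T).Adj x y) hx =>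
    absurd (hx ▸ ha) hadj.2.1) rfl

/-- A representative of the connected component of `v` in `G.isolate T`. -/
noncomputable def componentRep (G : SimpleGraph V) (T : Set V) (v : V) : V :=
  ((G.isolate T).connectedComponentMk v).out

lemma connectedComponentMk_componentRep (v : V) :
    (G.isolate T).connectedComponentMk (G.componentRep T v) =
      (G.isolate T).connectedComponentMk v :=
  Quot.out_eq _

lemma componentRep_eq_iff {v w : V} :
    G.componentRep T v = G.componentRep T w ↔ (G.isolate T).Reachable v w := by
  rw [← ConnectedComponent.eq]
  refine ⟨fun h => ?_, fun h => by rw [componentRep, h, componentRep]⟩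
  rw [← connectedComponentMk_componentRep, h, connectedComponentMk_componentRep]

lemma isRepFun_componentRep : IsRepFun T (G.componentRep T) where
  idem v := componentRep_eq_iff.2 (ConnectedComponent.eq.1 (connectedComponentMk_componentRep v))
  alone _ _ h hv := eq_of_reachable_isolate (componentRep_eq_iff.1 h) hv

/-! ### Binomial edge ideals are radical -/

section Radical

variable (K : Type*) [Field K]

lemma edgeMinor_mem_of_adj {i j : V} (h : G.Adj i j) : edgeMinor K i j ∈ G.binomialEdgeIdeal K :=
  Ideal.subset_span ⟨i, j, h, rfl⟩

/-- Induction along the path via x_k[i,j] = x_i[k,j] + x_j[i,k], or its analogue with y. Each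
interior vertex pays for one step with one of its variables, and on a path no vertex is charged
twice. -/
lemma monomial_mul_edgeMinor_mem {i j : V} (p : G.Walk i j) (hp : p.IsPath) (n : V ⊕ V →₀ ℕ)
    (hn : ∀ v ∈ p.support, v ≠ i → v ≠ j → n (Sum.inl v) ≠ 0 ∨ n (Sum.inr v) ≠ 0) :
    MvPolynomial.monomial n 1 * edgeMinor K i j ∈ G.binomialEdgeIdeal K := by
  classical
  induction p generalizing n with
  | nil => simp [edgeMinor_self]
  | @cons i k j hik q ih =>
    have hgen := edgeMinor_mem_of_adj K hik
    by_cases hkj : k = j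
    · subst hkj
      exact Ideal.mul_mem_left _ _ hgen
    rw [Walk.cons_isPath_iff] at hp
    have hki : k ≠ i := fun h => hp.2 (h ▸ q.start_mem_support)
    have step : ∀ e : V ⊕ V, (e = Sum.inl k ∨ e = Sum.inr k) → n e ≠ 0 →
        MvPolynomial.monomial (n - Finsupp.single e 1) 1 * edgeMinor K k j ∈
          G.binomialEdgeIdeal K := by
      intro e he _
      refine ih hp.1 _ fun v hv h1 h2 => ?_
      have h3 := hn v (by simp [hv]) (fun h => hp.2 (h ▸ hv)) h2
      rcases he with rfl | rfl <;> simpa [h1.symm] using h3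
    have split : ∀ e : V ⊕ V, n e ≠ 0 → MvPolynomial.monomial n (1 : K) =
        MvPolynomial.monomial (n - Finsupp.single e 1) 1 * MvPolynomial.X e := by
      intro e he
      rw [MvPolynomial.X, MvPolynomial.monomial_mul, one_mul, tsub_add_cancel_of_le]
      simpa [Nat.one_le_iff_ne_zero] using he
    rcases hn k (by simp) hki hkj with h | h
    · rw [split _ h]
      have h1 := Ideal.mul_mem_left _ (MvPolynomial.X (Sum.inl i)) (step _ (Or.inl rfl) h)
      have h2 := Ideal.mul_mem_left _ (MvPolynomial.monomial (n - Finsupp.single (Sum.inl k) 1) 1 *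
        MvPolynomial.X (Sum.inl j)) hgen
      convert Ideal.add_mem _ h1 h2 using 1
      simp only [edgeMinor]
      ring
    · rw [split _ h]
      have h1 := Ideal.mul_mem_left _ (MvPolynomial.X (Sum.inr i)) (step _ (Or.inr rfl) h)
      have h2 := Ideal.mul_mem_left _ (MvPolynomial.monomial (n - Finsupp.single (Sum.inr k) 1) 1 *
        MvPolynomial.X (Sum.inr j)) hgen
      convert Ideal.add_mem _ h1 h2 using 1
      simp only [edgeMinor]
      ring

/-- The exponent of the image of a monomial under a toric parametrization. -/
noncomputable def toricExp (c : V → V) : (V ⊕ V →₀ ℕ) →ₗ[ℕ] (Fin 3 × V →₀ ℕ) :=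
  Finsupp.linearCombination ℕ (Sum.elim
    (fun v => Finsupp.single (0, c v) 1 + Finsupp.single (2, v) 1)
    (fun v => Finsupp.single (1, c v) 1 + Finsupp.single (2, v) 1))

lemma toricExp_two [Fintype V] (c : V → V) (m : V ⊕ V →₀ ℕ) (v : V) :
    toricExp c m (2, v) = m (Sum.inl v) + m (Sum.inr v) := by
  classical
  rw [toricExp, Finsupp.linearCombination_apply, Finsupp.sum_fintype _ _ (by simp),
    Fintype.sum_sum_type]
  simp [Finsupp.single_apply]

open Classical in
lemma toricExp_zero [Fintype V] (c : V → V) (m : V ⊕ V →₀ ℕ) (k : V) :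
    toricExp c m (0, k) = ∑ v, if c v = k then m (Sum.inl v) else 0 := by
  rw [toricExp, Finsupp.linearCombination_apply, Finsupp.sum_fintype _ _ (by simp),
    Fintype.sum_sum_type]
  simp [Finsupp.single_apply]

lemma toricHom_monomial {c : V → V} {m : V ⊕ V →₀ ℕ}
    (hm : ∀ v ∈ T, m (Sum.inl v) = 0 ∧ m (Sum.inr v) = 0) :
    toricHom K T T c (MvPolynomial.monomial m 1) = MvPolynomial.monomial (toricExp c m) 1 := by
  rw [toricHom, MvPolynomial.aeval_monomial, map_one, one_mul, toricExp,
    Finsupp.linearCombination_apply, Finsupp.sum, MvPolynomial.monomial_sum_one]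
  refine Finset.prod_congr rfl fun e he => ?_
  rw [Finsupp.mem_support_iff] at he
  rcases e with v | v
  · have hv : v ∉ T := fun h => he (hm v h).1
    simp [hv, MvPolynomial.X, MvPolynomial.monomial_mul, MvPolynomial.monomial_pow]
  · have hv : v ∉ T := fun h => he (hm v h).2
    simp [hv, MvPolynomial.X, MvPolynomial.monomial_mul, MvPolynomial.monomial_pow]

lemma toricHom_monomial_eq_zero {c : V → V} {m : V ⊕ V →₀ ℕ} {v : V} (hv : v ∈ T)
    (hm : m (Sum.inl v) ≠ 0 ∨ m (Sum.inr v) ≠ 0) :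
    toricHom K T T c (MvPolynomial.monomial m 1) = 0 := by
  rw [toricHom, MvPolynomial.aeval_monomial, map_one, one_mul]
  rcases hm with hm | hm
  · exact Finset.prod_eq_zero (Finsupp.mem_support_iff.2 hm) (by simp [hv, hm])
  · exact Finset.prod_eq_zero (Finsupp.mem_support_iff.2 hm) (by simp [hv, hm])

/-- The vertices whose variables do not divide a monomial. -/
def zeroVerts (m : V ⊕ V →₀ ℕ) : Set V := {v | m (Sum.inl v) = 0 ∧ m (Sum.inr v) = 0}

/-- Monomials with the same image under the toric parametrization of the components of their
common support are congruent modulo the binomial edge ideal. -/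
lemma monomial_sub_monomial_mem [Finite V] (m' m : V ⊕ V →₀ ℕ)
    (h : toricExp (G.componentRep (zeroVerts m')) m = toricExp (G.componentRep (zeroVerts m')) m') :
    MvPolynomial.monomial m 1 - MvPolynomial.monomial m' 1 ∈ G.binomialEdgeIdeal K := by
  classical
  have := Fintype.ofFinite V
  induction hN : ∑ v, (m (Sum.inl v) - m' (Sum.inl v)) using Nat.strong_induction_on
    generalizing m with
  | _ N ih =>
  have hdeg : ∀ v, m (Sum.inl v) + m (Sum.inr v) = m' (Sum.inl v) + m' (Sum.inr v) := fun v => by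
    rw [← toricExp_two (G.componentRep (zeroVerts m')), h, toricExp_two]
  have hclass : ∀ k, (∑ v, if G.componentRep (zeroVerts m') v = k then m (Sum.inl v) else 0) =
      ∑ v, if G.componentRep (zeroVerts m') v = k then m' (Sum.inl v) else 0 := fun k => by
    rw [← toricExp_zero, h, toricExp_zero]
  by_cases hle : ∀ v, m (Sum.inl v) ≤ m' (Sum.inl v)
  · have heq : m = m' := by
      have h1 : ∀ v, m (Sum.inl v) = m' (Sum.inl v) := fun v => by
        have h2 := (Finset.sum_eq_sum_iff_of_le (fun x _ => by
          split_ifs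
          · exact hle x
          · exact le_rfl)).1 (hclass (G.componentRep (zeroVerts m') v)) v (Finset.mem_univ v)
        simpa using h2
      ext (v | v)
      · exact h1 v
      · have := hdeg v
        have := h1 v
        omega
    simp [heq]
  · push Not at hle
    -- Some i has too large an x-exponent; equal x-degrees on its class give a j there with too
    -- small a one. The total degrees at j agree, so y_j divides m, and x_i y_j can be traded for
    -- x_j y_i along a path of vertices occurring in m. This lowers the total excess.
    obtain ⟨i, hi⟩ := hle
    obtain ⟨j, hcj, hj⟩ : ∃ j, G.componentRep (zeroVerts m') j = G.componentRep (zeroVerts m') i ∧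
        m (Sum.inl j) < m' (Sum.inl j) := by
      by_contra! hcon
      refine (Finset.sum_lt_sum (fun x _ => ?_) ⟨i, Finset.mem_univ i, ?_⟩).ne'
        (hclass (G.componentRep (zeroVerts m') i))
      · split_ifs with hx
        · exact hcon x hx
        · exact le_rfl
      · simpa using hi
    have hij : i ≠ j := by
      rintro rfl
      omega
    have hr : (G.isolate (zeroVerts m')).Reachable i j := componentRep_eq_iff.1 hcj.symm
    obtain ⟨p, hp⟩ := hr.exists_isPath
    obtain ⟨n, hn⟩ : ∃ n, m = n + (Finsupp.single (Sum.inl i) 1 + Finsupp.single (Sum.inr j) 1) := by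
      refine ⟨m - (Finsupp.single (Sum.inl i) 1 + Finsupp.single (Sum.inr j) 1),
        (tsub_add_cancel_of_le ?_).symm⟩
      rintro (v | v)
      · by_cases hv : v = i
        · subst hv
          simp
          omega
        · simp [Ne.symm hv]
      · by_cases hv : v = j
        · subst hv
          have := hdeg v
          simp
          omega
        · simp [Ne.symm hv]
    set m₁ := n + (Finsupp.single (Sum.inl j) 1 + Finsupp.single (Sum.inr i) 1) with hm₁
    have hdiff : MvPolynomial.monomial m 1 - MvPolynomial.monomial m₁ 1 ∈
        G.binomialEdgeIdeal K := by
      have hmem := monomial_mul_edgeMinor_mem K (p.mapLe isolate_le) (hp.mapLe _) n ?_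
      · convert hmem using 1
        simp only [edgeMinor, hn, hm₁, MvPolynomial.X, mul_sub, MvPolynomial.monomial_mul, mul_one]
      · intro v hv hvi hvj
        rw [Walk.support_mapLe_eq_support] at hv
        have hvT : v ∉ zeroVerts m' := fun hvT =>
          hvi (eq_of_reachable_isolate (p.takeUntil v hv).reachable.symm hvT)
        have h1 := hdeg v
        have h2 : m (Sum.inl v) = n (Sum.inl v) := by simp [hn, Ne.symm hvi]
        have h3 : m (Sum.inr v) = n (Sum.inr v) := by simp [hn, Ne.symm hvj]
        simp only [zeroVerts, Set.mem_ofPred_eq] at hvT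
        omega
    have hexp : toricExp (G.componentRep (zeroVerts m')) m₁ =
        toricExp (G.componentRep (zeroVerts m')) m := by
      simp only [hm₁, hn, map_add, toricExp, Finsupp.linearCombination_single, Sum.elim_inl,
        Sum.elim_inr, hcj, one_smul]
      abel
    have hlt : ∑ v, (m₁ (Sum.inl v) - m' (Sum.inl v)) < N := by
      rw [← hN]
      have hval : ∀ v, m₁ (Sum.inl v) - m' (Sum.inl v) ≤ m (Sum.inl v) - m' (Sum.inl v) := by
        intro v
        simp only [hm₁, hn, Finsupp.add_apply, Finsupp.single_apply, Sum.inl.injEq, reduceCtorEq,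
          if_false]
        by_cases hv : j = v
        · subst hv
          simp [hn, Finsupp.single_apply] at hj
          simp [hij]
          omega
        · simp [hv]
          omega
      refine Finset.sum_lt_sum (fun v _ => hval v) ⟨i, Finset.mem_univ i, ?_⟩
      have h1 : m (Sum.inl i) = n (Sum.inl i) + 1 := by simp [hn]
      have h2 : m₁ (Sum.inl i) = n (Sum.inl i) := by simp [hm₁, hij.symm]
      omega
    have := Ideal.add_mem _ hdiff (ih _ hlt m₁ (hexp.trans h) rfl)
    simpa using this

lemma binomialEdgeIdeal_le_iff {P : Ideal (MvPolynomial (V ⊕ V) K)} :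
    G.binomialEdgeIdeal K ≤ P ↔ ∀ i j, G.Adj i j → edgeMinor K i j ∈ P := by
  refine ⟨fun h i j hij => h (edgeMinor_mem_of_adj K hij), fun h => Ideal.span_le.2 ?_⟩
  rintro _ ⟨i, j, hij, rfl⟩
  exact h i j hij

lemma binomialEdgeIdeal_le_ker (T : Set V) :
    G.binomialEdgeIdeal K ≤ RingHom.ker (toricHom K T T (G.componentRep T)) := by
  refine (binomialEdgeIdeal_le_iff K).2 fun i j hij => ?_
  by_cases hi : i ∈ T
  · exact Ideal.sub_mem _ (Ideal.mul_mem_right _ _ (X_inl_mem_ker_toricHom.2 hi))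
      (Ideal.mul_mem_left _ _ (X_inr_mem_ker_toricHom.2 hi))
  by_cases hj : j ∈ T
  · exact Ideal.sub_mem _ (Ideal.mul_mem_left _ _ (X_inr_mem_ker_toricHom.2 hj))
      (Ideal.mul_mem_right _ _ (X_inl_mem_ker_toricHom.2 hj))
  exact isRepFun_componentRep.edgeMinor_mem
    (componentRep_eq_iff.2 (Adj.reachable (G := G.isolate T) ⟨hij, hi, hj⟩))

/-- An element of all the toric primes is in the binomial edge ideal. -/
lemma mem_binomialEdgeIdeal_of_forall [Finite V] (f : MvPolynomial (V ⊕ V) K)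
    (hf : ∀ T : Set V, f ∈ RingHom.ker (toricHom K T T (G.componentRep T))) :
    f ∈ G.binomialEdgeIdeal K := by
  classical
  induction hN : f.support.card using Nat.strong_induction_on generalizing f with
  | _ N ih =>
  by_cases hf0 : f = 0
  · simp [hf0]
  obtain ⟨m, hm⟩ := MvPolynomial.support_nonempty.2 hf0
  -- For T the set of vertices not occurring in m, the image of m is a nonzero monomial. Since f
  -- maps to 0, another monomial of f must have the same image.
  obtain ⟨m', hm', hne, hexp⟩ : ∃ m' ∈ f.support, m' ≠ m ∧
      toricExp (G.componentRep (zeroVerts m)) m' = toricExp (G.componentRep (zeroVerts m)) m := by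
    by_contra! hcon
    have h0 : toricHom K (zeroVerts m) (zeroVerts m) (G.componentRep (zeroVerts m)) f = 0 :=
      hf (zeroVerts m)
    rw [f.as_sum, map_sum] at h0
    have h1 := congrArg
      (MvPolynomial.coeff (toricExp (G.componentRep (zeroVerts m)) m)) h0
    rw [MvPolynomial.coeff_sum, Finset.sum_eq_single_of_mem m hm] at h1
    · rw [← mul_one (MvPolynomial.coeff m f), ← MvPolynomial.C_mul_monomial,
        ← MvPolynomial.algebraMap_eq, map_mul, AlgHom.commutes,
        toricHom_monomial K (T := zeroVerts m) (fun v hv => hv), MvPolynomial.algebraMap_eq] at h1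
      simp at h1
      exact MvPolynomial.mem_support_iff.1 hm h1
    · intro m' hm' hne
      rw [← mul_one (MvPolynomial.coeff m' f), ← MvPolynomial.C_mul_monomial,
        ← MvPolynomial.algebraMap_eq, map_mul, AlgHom.commutes, MvPolynomial.algebraMap_eq]
      by_cases hz : ∀ v ∈ zeroVerts m, m' (Sum.inl v) = 0 ∧ m' (Sum.inr v) = 0
      · rw [toricHom_monomial K hz]
        simp [MvPolynomial.coeff_monomial, hcon m' hm' hne]
      · push Not at hz
        obtain ⟨v, hv, hv'⟩ := hz
        rw [toricHom_monomial_eq_zero K hv (by tauto)]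
        simp
  have hdiff := monomial_sub_monomial_mem K m m' hexp
  have hmem := Ideal.mul_mem_left _ (MvPolynomial.C (MvPolynomial.coeff m f)) hdiff
  rw [mul_sub, MvPolynomial.C_mul_monomial, MvPolynomial.C_mul_monomial, mul_one] at hmem
  -- Trading m for m' modulo the ideal removes m from the support and adds nothing new.
  have hlt : (f + (MvPolynomial.monomial m' (MvPolynomial.coeff m f) -
      MvPolynomial.monomial m (MvPolynomial.coeff m f))).support.card < N := by
    rw [← hN]
    refine Finset.card_lt_card (Finset.ssubset_iff_of_subset ?_ |>.2 ⟨m, hm, ?_⟩)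
    · intro e he
      by_contra hef
      have h1 : m ≠ e := fun h => hef (h ▸ hm)
      have h2 : m' ≠ e := fun h => hef (h ▸ hm')
      rw [MvPolynomial.notMem_support_iff] at hef
      simp [hef, MvPolynomial.coeff_monomial, h1, h2] at he
    · simp [MvPolynomial.coeff_monomial, hne]
  have h2 := ih _ hlt _ (fun T => Ideal.add_mem _ (hf T) (binomialEdgeIdeal_le_ker K T hmem)) rfl
  exact (Ideal.add_mem_iff_left _ hmem).1 h2

theorem isRadical_binomialEdgeIdeal [Finite V] : (G.binomialEdgeIdeal K).IsRadical := by
  rintro f ⟨n, hn⟩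
  exact mem_binomialEdgeIdeal_of_forall K f fun T =>
    isPrime_ker_toricHom.mem_of_pow_mem n (binomialEdgeIdeal_le_ker K T hn)

end Radical

/-! ### Associated primes of binomial edge ideals -/

/-- Every vertex of `T` has two neighbours in different components of `G ∖ T`. -/
def SeparatesAtEach (G : SimpleGraph V) (T : Set V) : Prop :=
  ∀ v ∈ T, ∃ a b, G.Adj v a ∧ G.Adj v b ∧ a ∉ T ∧ b ∉ T ∧ ¬ (G.isolate T).Reachable a b

section Primes

variable {K : Type*} [Field K]

/-- Minors propagate along an edge {s, t} off T by x_s[v,t] = x_v[s,t] + x_t[v,s] and its analogue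
with y: since s ∉ T, one of the two variables at s lies outside P and can be cancelled. -/
lemma ker_toricHom_componentRep_le {P : Ideal (MvPolynomial (V ⊕ V) K)} [hP : P.IsPrime]
    (hJ : G.binomialEdgeIdeal K ≤ P)
    (hT : T = {v | MvPolynomial.X (Sum.inl v) ∈ P ∧ MvPolynomial.X (Sum.inr v) ∈ P}) :
    RingHom.ker (toricHom K T T (G.componentRep T)) ≤ P := by
  refine ker_toricHom_le (fun v hv => ?_) (fun v hv => ?_) (fun v w hvw => ?_)
  · rw [hT] at hv
    exact hv.1
  · rw [hT] at hv
    exact hv.2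
  · rw [componentRep_eq_iff] at hvw
    refine hvw.closed (P := fun x => edgeMinor K v x ∈ P) (fun x y hxy hx => ?_)
      (by simp [edgeMinor_self])
    have hgen : edgeMinor K x y ∈ P := hJ (edgeMinor_mem_of_adj K hxy.1)
    have hxT := hxy.2.1
    rw [hT, Set.mem_ofPred_eq, not_and_or] at hxT
    rcases hxT with h | h
    · refine (hP.mem_or_mem (?_ : MvPolynomial.X (Sum.inl x) * _ ∈ P)).resolve_left h
      have h1 := P.add_mem (P.mul_mem_left (MvPolynomial.X (Sum.inl v)) hgen)
        (P.mul_mem_left (MvPolynomial.X (Sum.inl y)) hx)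
      convert h1 using 1
      simp only [edgeMinor]
      ring
    · refine (hP.mem_or_mem (?_ : MvPolynomial.X (Sum.inr x) * _ ∈ P)).resolve_left h
      have h1 := P.add_mem (P.mul_mem_left (MvPolynomial.X (Sum.inr v)) hgen)
        (P.mul_mem_left (MvPolynomial.X (Sum.inr y)) hx)
      convert h1 using 1
      simp only [edgeMinor]
      ring

/-- A walk through v can be rerouted, since the neighbours of v used before and after it are joined
off T. -/
lemma reachable_isolate_diff {v a b : V} (hav : a ≠ v) (hbv : b ≠ v)
    (hnb : ∀ x y, G.Adj v x → G.Adj v y → x ∉ T → y ∉ T → (G.isolate T).Reachable x y)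
    (h : (G.isolate (T \ {v})).Reachable a b) : (G.isolate T).Reachable a b := by
  have h1 := h.closed (P := fun x => (x = v ∧ ∃ c, G.Adj v c ∧ c ∉ T ∧ (G.isolate T).Reachable a c)
    ∨ (x ≠ v ∧ (G.isolate T).Reachable a x)) ?_ (Or.inr ⟨hav, .refl _⟩)
  · exact (h1.resolve_left fun h' => hbv h'.1).2
  · intro x y hxy hx
    by_cases hyv : y = v
    · subst hyv
      have hxv : x ≠ y := hxy.1.ne
      refine Or.inl ⟨rfl, x, hxy.1.symm, fun hxT => hxy.2.1 ⟨hxT, hxv⟩, ?_⟩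
      exact (hx.resolve_left fun h' => hxv h'.1).2
    · have hyT : y ∉ T := fun hyT => hxy.2.2 ⟨hyT, hyv⟩
      refine Or.inr ⟨hyv, ?_⟩
      rcases hx with ⟨rfl, c, hc, hcT, hac⟩ | ⟨hxv, hax⟩
      · exact hac.trans (hnb _ _ hc hxy.1 hcT hyT)
      · exact hax.trans (Adj.reachable (G := G.isolate T)
          ⟨hxy.1, fun hxT => hxy.2.1 ⟨hxT, hxv⟩, hyT⟩)

/-- A minimal prime of the binomial edge ideal is a toric prime for a separating set. -/
theorem exists_eq_ker_toricHom {P : Ideal (MvPolynomial (V ⊕ V) K)}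
    (hP : P ∈ (G.binomialEdgeIdeal K).minimalPrimes) :
    ∃ T, G.SeparatesAtEach T ∧ P = RingHom.ker (toricHom K T T (G.componentRep T)) := by
  have := hP.1.1
  obtain ⟨T, hT⟩ : ∃ T : Set V,
      T = {v | MvPolynomial.X (Sum.inl v) ∈ P ∧ MvPolynomial.X (Sum.inr v) ∈ P} := ⟨_, rfl⟩
  have hle := ker_toricHom_componentRep_le hP.1.2 hT
  have heq : P = RingHom.ker (toricHom K T T (G.componentRep T)) :=
    le_antisymm (hP.2 ⟨isPrime_ker_toricHom, binomialEdgeIdeal_le_ker K T⟩ hle) hle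
  refine ⟨T, fun v hv => ?_, heq⟩
  by_contra! hcon
  -- If v does not separate, restoring it merges no components, so the prime of T \ {v} lies in P.
  -- By minimality it would contain x_v, which it does not.
  have hle' : RingHom.ker (toricHom K (T \ {v}) (T \ {v}) (G.componentRep (T \ {v}))) ≤ P := by
    rw [heq]
    refine ker_toricHom_le (fun x hx => X_inl_mem_ker_toricHom.2 hx.1)
      (fun x hx => X_inr_mem_ker_toricHom.2 hx.1) (fun x y hxy => ?_)
    by_cases hxv : x = v
    · subst hxv
      exact Ideal.sub_mem _ (Ideal.mul_mem_right _ _ (X_inl_mem_ker_toricHom.2 hv))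
        (Ideal.mul_mem_left _ _ (X_inr_mem_ker_toricHom.2 hv))
    by_cases hyv : y = v
    · subst hyv
      exact Ideal.sub_mem _ (Ideal.mul_mem_left _ _ (X_inr_mem_ker_toricHom.2 hv))
        (Ideal.mul_mem_right _ _ (X_inl_mem_ker_toricHom.2 hv))
    exact isRepFun_componentRep.edgeMinor_mem (componentRep_eq_iff.2
      (reachable_isolate_diff hxv hyv (fun a b ha hb haT hbT => hcon a b ha hb haT hbT)
        (componentRep_eq_iff.1 hxy)))
  have h1 : MvPolynomial.X (Sum.inl v) ∈
      RingHom.ker (toricHom K (T \ {v}) (T \ {v}) (G.componentRep (T \ {v}))) :=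
    hP.2 ⟨isPrime_ker_toricHom, binomialEdgeIdeal_le_ker K _⟩ hle'
      (heq ▸ X_inl_mem_ker_toricHom.2 hv)
  exact (X_inl_mem_ker_toricHom.1 h1).2 rfl

/-- P is the annihilator of the class of some f. Radicality keeps f out of P, so a prime between I
and P contains each g ∈ P because gf ∈ I. -/
lemma mem_minimalPrimes_of_mem_associatedPrimes {R : Type*} [CommRing R] [IsNoetherianRing R]
    {I P : Ideal R} (hI : I.IsRadical) (hP : P ∈ associatedPrimes R (R ⧸ I)) :
    P ∈ I.minimalPrimes := by
  obtain ⟨hprime, x, hx⟩ := isAssociatedPrime_iff.1 hP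
  obtain ⟨f, rfl⟩ := Ideal.Quotient.mk_surjective x
  have hmem : ∀ g, g ∈ P ↔ g * f ∈ I := fun g => by
    rw [hx, Submodule.mem_colon_singleton, Submodule.mem_bot, Algebra.smul_def,
      Ideal.Quotient.algebraMap_eq, ← map_mul, Ideal.Quotient.eq_zero_iff_mem]
  have hf : f ∉ P := fun hf => hprime.ne_top ((Ideal.eq_top_iff_one _).2 ((hmem 1).2 (by
    rw [one_mul]
    exact hI ⟨2, by simpa [sq] using (hmem f).1 hf⟩)))
  refine ⟨⟨hprime, fun g hg => (hmem g).2 (I.mul_mem_right _ hg)⟩, fun Q hQ hQP g hg => ?_⟩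
  exact (hQ.1.mem_or_mem (hQ.2 ((hmem g).1 hg))).resolve_right fun h => hf (hQP h)

/-- Each component contains exactly one fixed point of the representative function, so |V| minus the
number of components counts the merged vertices; T contributes two variables per vertex. -/
lemma ncard_heightIndex_add [Finite V] :
    (heightIndex T (G.componentRep T)).ncard + Nat.card (G.isolate T).ConnectedComponent =
      Nat.card V + 2 * T.ncard := by
  set c := G.componentRep T with hc
  have h1 : heightIndex T c = Sum.inl '' (T ∪ {v | c v ≠ v}) ∪ Sum.inr '' T := by
    ext (v | v) <;> simp [heightIndex]
  have hd : Disjoint T {v | c v ≠ v} :=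
    Set.disjoint_left.2 fun v hv h' => h' (isRepFun_componentRep.fix hv)
  have h2 : (heightIndex T c).ncard = T.ncard + {v | c v ≠ v}.ncard + T.ncard := by
    rw [h1, Set.ncard_union_eq, Set.ncard_image_of_injective _ Sum.inl_injective,
      Set.ncard_image_of_injective _ Sum.inr_injective, Set.ncard_union_eq hd]
    rw [Set.disjoint_left]
    rintro _ ⟨a, _, rfl⟩ ⟨b, _, h⟩
    simp at h
  have h3 : {v | c v = v}.ncard = Nat.card (G.isolate T).ConnectedComponent := by
    rw [← Nat.card_coe_set_eq]
    refine Nat.card_congr (Equiv.ofBijective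
      (fun v => (G.isolate T).connectedComponentMk v.1) ⟨?_, ?_⟩)
    · rintro ⟨v, hv⟩ ⟨w, hw⟩ h
      rw [ConnectedComponent.eq, ← componentRep_eq_iff] at h
      exact Subtype.ext (hv.symm.trans (h.trans hw))
    · intro C
      induction C using ConnectedComponent.ind with
      | _ v =>
        exact ⟨⟨c v, isRepFun_componentRep.idem v⟩, connectedComponentMk_componentRep v⟩
  have h4 : {v | c v = v}.ncard + {v | c v ≠ v}.ncard = Nat.card V :=
    Set.ncard_add_ncard_compl {v | c v = v}
  omega

/-- If every separating set `T` leaves the same number of components relative to its size, then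
the binomial edge ideal is unmixed. -/
theorem isUnmixed_binomialEdgeIdeal [Finite V]
    (h : ∀ T, G.SeparatesAtEach T →
      Nat.card (G.isolate T).ConnectedComponent = 2 * T.ncard + 1) :
    (G.binomialEdgeIdeal K).IsUnmixed := by
  have key : ∀ P ∈ associatedPrimes (MvPolynomial (V ⊕ V) K)
      (MvPolynomial (V ⊕ V) K ⧸ G.binomialEdgeIdeal K),
      P.height = (Nat.card V - 1 : ℕ) := by
    intro P hP
    obtain ⟨T, hT, rfl⟩ := exists_eq_ker_toricHom
      (mem_minimalPrimes_of_mem_associatedPrimes (isRadical_binomialEdgeIdeal K) hP)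
    have h1 := ncard_heightIndex_add (G := G) (T := T)
    have h2 := h T hT
    rw [isRepFun_componentRep.height_eq]
    congr 1
    omega
  intro P hP Q hQ
  exact (key P hP).trans (key Q hQ).symm

end Primes

end SimpleGraph

/-! ### Counting components -/

namespace SimpleGraph

variable {V : Type*} {G : SimpleGraph V} {T : Set V}

/-- Isolating a further vertex which touches exactly two components of what remains creates
two new components. -/
theorem card_connectedComponent_isolate_insert [Finite V] {v a b : V} (hv : v ∉ T)
    (hva : G.Adj v a) (hvb : G.Adj v b) (ha : a ∉ T) (hb : b ∉ T)
    (hab : ¬ (G.isolate (insert v T)).Reachable a b)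
    (hcov : ∀ c, G.Adj v c → c ∉ T → (G.isolate (insert v T)).Reachable a c ∨
      (G.isolate (insert v T)).Reachable b c) :
    Nat.card (G.isolate (insert v T)).ConnectedComponent =
      Nat.card (G.isolate T).ConnectedComponent + 2 := by
  have hle : G.isolate (insert v T) ≤ G.isolate T := isolate_anti (Set.subset_insert _ _)
  have hvT : v ∈ insert v T := Set.mem_insert _ _
  have hadj : ∀ x y, (G.isolate T).Adj x y → x ≠ v → y ≠ v →
      (G.isolate (insert v T)).Adj x y := fun x y h hx hy =>
    ⟨h.1, by simp [hx, h.2.1], by simp [hy, h.2.2]⟩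
  have hclosed : ∀ x y, (G.isolate T).Adj x y →
      (x = v ∨ (G.isolate (insert v T)).Reachable a x ∨ (G.isolate (insert v T)).Reachable b x) →
      (y = v ∨ (G.isolate (insert v T)).Reachable a y ∨
        (G.isolate (insert v T)).Reachable b y) := by
    intro x y hxy hx
    by_cases hy : y = v
    · exact Or.inl hy
    by_cases hxv : x = v
    · subst hxv
      exact Or.inr (hcov y hxy.1 hxy.2.2)
    · have h := (hadj x y hxy hxv hy).reachable
      exact Or.inr ((hx.resolve_left hxv).imp (·.trans h) (·.trans h))
  have hmem : ∀ x, (x = v ∨ (G.isolate (insert v T)).Reachable a x ∨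
      (G.isolate (insert v T)).Reachable b x) → (G.isolate T).Reachable v x := by
    rintro x (rfl | h | h)
    · exact .refl _
    · exact (Adj.reachable (G := G.isolate T) ⟨hva, hv, ha⟩).trans (h.mono hle)
    · exact (Adj.reachable (G := G.isolate T) ⟨hvb, hv, hb⟩).trans (h.mono hle)
  let A : Set (G.isolate (insert v T)).ConnectedComponent :=
    {(G.isolate (insert v T)).connectedComponentMk a, (G.isolate (insert v T)).connectedComponentMk b}
  have hA : A.ncard = 2 := Set.ncard_pair fun h => hab (ConnectedComponent.eq.1 h)
  -- The components other than those of a and b match the old components, with {v} standing for the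
  -- old component of v.
  have hbij : Nat.card (Aᶜ : Set _) = Nat.card (G.isolate T).ConnectedComponent := by
    refine Nat.card_congr (Equiv.ofBijective
      (fun C => C.1.map (Hom.ofLE hle)) ⟨?_, ?_⟩)
    · rintro ⟨C, hC⟩ ⟨C', hC'⟩ h
      induction C using ConnectedComponent.ind with | _ x
      induction C' using ConnectedComponent.ind with | _ y
      simp only [A, Set.mem_compl_iff, Set.mem_insert_iff, Set.mem_singleton_iff,
        ConnectedComponent.eq, not_or] at hC hC'
      have hxy : (G.isolate T).Reachable x y := ConnectedComponent.eq.1 h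
      rw [Subtype.mk.injEq, ConnectedComponent.eq]
      by_cases hx : x = v
      · have hy := hxy.closed hclosed (Or.inl hx)
        rcases hy with hy | hy | hy
        · rw [hx, hy]
        · exact absurd hy.symm hC'.1
        · exact absurd hy.symm hC'.2
      · refine (hxy.closed (P := fun z => (G.isolate (insert v T)).Reachable x z ∧
          ¬ (z = v ∨ (G.isolate (insert v T)).Reachable a z ∨
            (G.isolate (insert v T)).Reachable b z)) (fun z z' hzz' hz => ?_)
          ⟨.refl _, ?_⟩).1
        · have hz' := fun h => hz.2 (hclosed _ _ hzz'.symm h)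
          exact ⟨hz.1.trans (hadj z z' hzz' (fun h => hz.2 (Or.inl h))
            (fun h => hz' (Or.inl h))).reachable, hz'⟩
        · rintro (h | h | h)
          · exact hx h
          · exact hC.1 h.symm
          · exact hC.2 h.symm
    · intro C
      induction C using ConnectedComponent.ind with | _ x
      by_cases hx : x = v ∨ (G.isolate (insert v T)).Reachable a x ∨
        (G.isolate (insert v T)).Reachable b x
      · refine ⟨⟨(G.isolate (insert v T)).connectedComponentMk v, ?_⟩,
          ConnectedComponent.eq.2 (hmem x hx)⟩
        simp only [A, Set.mem_compl_iff, Set.mem_insert_iff, Set.mem_singleton_iff,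
          ConnectedComponent.eq, not_or]
        exact ⟨fun h => hva.ne (eq_of_reachable_isolate h hvT),
          fun h => hvb.ne (eq_of_reachable_isolate h hvT)⟩
      · refine ⟨⟨(G.isolate (insert v T)).connectedComponentMk x, ?_⟩, rfl⟩
        simp only [A, Set.mem_compl_iff, Set.mem_insert_iff, Set.mem_singleton_iff,
          ConnectedComponent.eq, not_or]
        exact ⟨fun h => hx (Or.inr (Or.inl h.symm)), fun h => hx (Or.inr (Or.inr h.symm))⟩
  rw [← hbij, Nat.card_coe_set_eq, ← hA, add_comm, Set.ncard_add_ncard_compl]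

/-! ### Whiskers -/

section Whiskers

variable {B : SimpleGraph V} {W : Set V}

@[simp]
lemma addWhiskers_adj_inl_inl {v v' : V} :
    (B.addWhiskers W).Adj (Sum.inl v) (Sum.inl v') ↔ B.Adj v v' := by
  simp only [addWhiskers, fromRel_adj]
  exact ⟨fun h => h.2.elim id Adj.symm, fun h => ⟨by simpa using h.ne, Or.inl h⟩⟩

@[simp]
lemma addWhiskers_adj_inl_inr {v : V} {f : W} :
    (B.addWhiskers W).Adj (Sum.inl v) (Sum.inr f) ↔ v = f := by
  simp [addWhiskers]

@[simp]
lemma addWhiskers_adj_inr_inl {v : V} {f : W} :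
    (B.addWhiskers W).Adj (Sum.inr f) (Sum.inl v) ↔ v = f := by
  rw [adj_comm, addWhiskers_adj_inl_inr]

@[simp]
lemma addWhiskers_adj_inr_inr {f f' : W} :
    ¬ (B.addWhiskers W).Adj (Sum.inr f) (Sum.inr f') := by
  simp [addWhiskers]

/-- The retraction of a graph with whiskers that sends each leaf to its neighbour. -/
def whiskerBase (x : V ⊕ W) : V := Sum.elim id (fun f => f.1) x

lemma Reachable.isolate_addWhiskers {S : Set (V ⊕ W)} {a b : V}
    (h : (B.isolate (Sum.inl ⁻¹' S)).Reachable a b) :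
    ((B.addWhiskers W).isolate S).Reachable (Sum.inl a) (Sum.inl b) :=
  h.map (⟨Sum.inl, fun h => ⟨addWhiskers_adj_inl_inl.2 h.1, h.2.1, h.2.2⟩⟩ :
    B.isolate (Sum.inl ⁻¹' S) →g (B.addWhiskers W).isolate S)

/-- Leaves are dead ends: collapsing each onto its neighbour turns walks into walks of B. -/
lemma Reachable.whiskerBase {S : Set (V ⊕ W)} {x y : V ⊕ W}
    (h : ((B.addWhiskers W).isolate S).Reachable x y) :
    (B.isolate (Sum.inl ⁻¹' S)).Reachable (whiskerBase x) (whiskerBase y) := by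
  refine h.closed (P := fun z => (B.isolate (Sum.inl ⁻¹' S)).Reachable
    (SimpleGraph.whiskerBase x) (SimpleGraph.whiskerBase z)) (fun z z' hz hx => hx.trans ?_)
    (.refl _)
  rcases z with z | z <;> rcases z' with z' | z'
  · exact Adj.reachable (G := B.isolate _) ⟨addWhiskers_adj_inl_inl.1 hz.1, hz.2.1, hz.2.2⟩
  · have : z = z' := addWhiskers_adj_inl_inr.1 hz.1
    rw [this]
    exact .refl _
  · have : z' = z := addWhiskers_adj_inr_inl.1 hz.1
    rw [this]
    exact .refl _
  · exact absurd hz.1 addWhiskers_adj_inr_inr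

lemma preconnected_addWhiskers_isolate_empty (hB : B.Preconnected) :
    ((B.addWhiskers W).isolate ∅).Preconnected := by
  have h0 : ∀ a b : V, ((B.addWhiskers W).isolate ∅).Reachable (Sum.inl a) (Sum.inl b) :=
    fun a b => Reachable.isolate_addWhiskers ((hB a b).mono fun x y h => ⟨h, by simp, by simp⟩)
  have h1 : ∀ x : V ⊕ W, ((B.addWhiskers W).isolate ∅).Reachable x
      (Sum.inl (whiskerBase x)) := by
    rintro (v | f)
    · exact .refl _
    · exact Adj.reachable (G := (B.addWhiskers W).isolate ∅)
        ⟨addWhiskers_adj_inr_inl.2 rfl, by simp, by simp⟩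
  exact fun x y => (h1 x).trans ((h0 _ _).trans (h1 y).symm)

/-- The number of components left by a separating set of a graph with whiskers, provided that
sets of whiskered vertices do not disconnect `B`, and that the other vertices separate exactly
two components, already in the presence of the whiskered vertices alone. -/
theorem card_connectedComponent_isolate_addWhiskers [Finite V] [Nonempty V]
    (hconn : ∀ S ⊆ W, ∀ a ∉ S, ∀ b ∉ S, (B.isolate S).Reachable a b)
    (hsep : ∀ (T : Set V) (u a b : V), u ∉ W → u ∈ T → a ∉ T → b ∉ T → B.Adj u a → B.Adj u b →
      ¬ (B.isolate T).Reachable a b →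
      ¬ (B.isolate (insert u (T ∩ W))).Reachable a b ∧
        ∀ c, B.Adj u c → c = a ∨ c = b ∨ B.Adj a c ∨ B.Adj b c)
    {T : Set (V ⊕ W)} (hT : (B.addWhiskers W).SeparatesAtEach T) :
    Nat.card ((B.addWhiskers W).isolate T).ConnectedComponent = 2 * T.ncard + 1 := by
  set T' : Set V := Sum.inl ⁻¹' T with hT'
  have hleaf : ∀ f : W, Sum.inr f ∉ T := fun f hf => by
    obtain ⟨a, b, ha, hb, -, -, hab⟩ := hT _ hf
    rcases a with a | a <;> rcases b with b | b <;> simp at ha hb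
    rw [ha, hb] at hab
    exact hab (.refl _)
  have hTT' : T = Sum.inl '' T' := by
    ext (v | f) <;> simp [hT', hleaf]
  have hpre : ∀ S : Set V, (Sum.inl ⁻¹' (Sum.inl '' S : Set (V ⊕ W))) = S := fun S =>
    Set.preimage_image_eq _ Sum.inl_injective
  have stepW : ∀ S ⊆ T' ∩ W, Nat.card ((B.addWhiskers W).isolate (Sum.inl '' S)).ConnectedComponent
      = 2 * S.ncard + 1 := by
    intro S hS
    induction S, Set.toFinite S using Set.Finite.induction_on with
    | empty =>
      rw [Set.image_empty, Set.ncard_empty]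
      have h1 := preconnected_addWhiskers_isolate_empty (W := W)
        (fun a b => (hconn ∅ (by simp) a (by simp) b (by simp)).mono isolate_le : B.Preconnected)
      have := h1.subsingleton_connectedComponent
      have : Nonempty ((B.addWhiskers W).isolate ∅).ConnectedComponent :=
        ⟨connectedComponentMk _ (Sum.inl (Classical.arbitrary V))⟩
      simp
    | @insert w S hwS hSf ih =>
      have hw : w ∈ T' ∩ W := hS (Set.mem_insert _ _)
      have hS' : S ⊆ T' ∩ W := (Set.subset_insert _ _).trans hS
      -- Of two separated neighbours of w at most one is its leaf, so something of B remains next to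
      -- w and forms the second piece.
      obtain ⟨b, hwb, hbT⟩ : ∃ b, B.Adj w b ∧ b ∉ T' := by
        obtain ⟨a, b, ha, hb, haT, hbT, hab⟩ := hT _ hw.1
        rcases a with a | a
        · exact ⟨a, by simpa using ha, haT⟩
        rcases b with b | b
        · exact ⟨b, by simpa using hb, hbT⟩
        rw [addWhiskers_adj_inl_inr] at ha hb
        exact absurd (by rw [Subtype.ext (ha.symm.trans hb)]) hab
      have hbS : b ∉ insert w S := fun h => hbT (hS h).1
      rw [Set.image_insert_eq, card_connectedComponent_isolate_insert (a := Sum.inr ⟨w, hw.2⟩)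
        (b := Sum.inl b), ih hS', Set.ncard_insert_of_notMem hwS hSf]
      · ring
      · simpa using hwS
      · simp
      · simpa using hwb
      · simp
      · simpa using fun h => hbS (Or.inr h)
      · intro h
        have := h.closed (P := fun x => x = Sum.inr ⟨w, hw.2⟩) ?_ rfl
        · simp at this
        · rintro x y hxy rfl
          rcases y with y | y
          · have := addWhiskers_adj_inr_inl.1 hxy.1
            exact absurd (Set.mem_insert_iff.2 (Or.inl (by rw [this]))) hxy.2.2
          · exact absurd hxy.1 addWhiskers_adj_inr_inr
      · rintro (c | c) hc hcS
        · right
          rw [← Set.image_insert_eq]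
          apply Reachable.isolate_addWhiskers
          rw [hpre]
          refine hconn _ (fun x hx => (hS hx).2) _ hbS _ ?_
          rw [addWhiskers_adj_inl_inl] at hc
          simp only [Set.mem_insert_iff, not_or]
          exact ⟨hc.ne', by simpa using hcS⟩
        · left
          rw [addWhiskers_adj_inl_inr] at hc
          subst hc
          exact .refl _
  -- Separation by T need not persist for a smaller set. It is available at every intermediate stage
  -- here because `hsep` already separates with u and T ∩ W, which is why the whiskered vertices go
  -- first.
  have stepU : ∀ X ⊆ T' \ W, Nat.card
      ((B.addWhiskers W).isolate (Sum.inl '' (X ∪ (T' ∩ W)))).ConnectedComponent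
      = 2 * (X ∪ (T' ∩ W)).ncard + 1 := by
    intro X hX
    induction X, Set.toFinite X using Set.Finite.induction_on with
    | empty =>
      rw [Set.empty_union]
      exact stepW _ subset_rfl
    | @insert u X huX hXf ih =>
      have hu : u ∈ T' \ W := hX (Set.mem_insert _ _)
      have hX' : X ⊆ T' \ W := (Set.subset_insert _ _).trans hX
      have huS : u ∉ X ∪ (T' ∩ W) := fun h => h.elim huX fun h => hu.2 h.2
      have hST : X ∪ (T' ∩ W) ⊆ T' := Set.union_subset (fun x hx => (hX' hx).1) fun x hx => hx.1
      have hnb : ∀ x, (B.addWhiskers W).Adj (Sum.inl u) x → ∃ v, x = Sum.inl v := by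
        rintro (v | f) h
        · exact ⟨v, rfl⟩
        · exact absurd (addWhiskers_adj_inl_inr.1 h ▸ f.2) hu.2
      obtain ⟨a', b', ha, hb, haT, hbT, hab⟩ := hT _ hu.1
      obtain ⟨a, rfl⟩ := hnb _ ha
      obtain ⟨b, rfl⟩ := hnb _ hb
      rw [addWhiskers_adj_inl_inl] at ha hb
      obtain ⟨hsep1, hsep2⟩ := hsep T' u a b hu.2 hu.1 haT hbT ha hb
        fun h => hab h.isolate_addWhiskers
      have hnotin : ∀ x ∉ T', x ∉ insert u (X ∪ (T' ∩ W)) := fun x hx h =>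
        hx (Set.insert_subset hu.1 hST h)
      rw [Set.insert_union, Set.image_insert_eq, card_connectedComponent_isolate_insert
        (a := Sum.inl a) (b := Sum.inl b), ih hX',
        Set.ncard_insert_of_notMem huS (Set.toFinite _)]
      · ring
      · simpa using huS
      · simpa using ha
      · simpa using hb
      · rw [Sum.inl_injective.mem_set_image]
        exact fun h => haT (hST h)
      · rw [Sum.inl_injective.mem_set_image]
        exact fun h => hbT (hST h)
      · intro h
        rw [← Set.image_insert_eq] at h
        have h1 := h.whiskerBase
        rw [hpre] at h1
        exact hsep1 (h1.mono (isolate_anti (Set.insert_subset_insert Set.subset_union_right)))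
      · intro x hx hxS
        obtain ⟨c, rfl⟩ := hnb _ hx
        rw [addWhiskers_adj_inl_inl] at hx
        rw [Sum.inl_injective.mem_set_image] at hxS
        have hc : c ∉ insert u (X ∪ (T' ∩ W)) := fun h => h.elim hx.ne' hxS
        rw [← Set.image_insert_eq]
        have hadj : ∀ d ∉ T', B.Adj d c → ((B.addWhiskers W).isolate
            (Sum.inl '' insert u (X ∪ (T' ∩ W)))).Reachable (Sum.inl d) (Sum.inl c) :=
          fun d hd hdc => Adj.reachable (G := (B.addWhiskers W).isolate _)
            ⟨addWhiskers_adj_inl_inl.2 hdc, by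
              rw [Sum.inl_injective.mem_set_image]; exact hnotin d hd, by
              rw [Sum.inl_injective.mem_set_image]; exact hc⟩
        rcases hsep2 c hx with rfl | rfl | h | h
        · exact Or.inl (.refl _)
        · exact Or.inr (.refl _)
        · exact Or.inl (hadj a haT h)
        · exact Or.inr (hadj b hbT h)
  have hfin := stepU (T' \ W) subset_rfl
  rwa [Set.sdiff_union_inter, ← hTT', ← Set.ncard_image_of_injective T' (Sum.inl_injective (β := W)),
    ← hTT'] at hfin

end Whiskers

end SimpleGraph

/-! ### Cutpoints of graphs with whiskers -/

namespace SimpleGraph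

variable {V : Type*} {G : SimpleGraph V} {T : Set V}

lemma reachable_induce_compl_iff {a b : V} (ha : a ∈ Tᶜ) (hb : b ∈ Tᶜ) :
    (G.induce Tᶜ).Reachable ⟨a, ha⟩ ⟨b, hb⟩ ↔ (G.isolate T).Reachable a b := by
  refine ⟨fun h => h.map (⟨Subtype.val, fun {x y} h => ⟨h, x.2, y.2⟩⟩ :
    G.induce Tᶜ →g G.isolate T), fun h => ?_⟩
  obtain ⟨_, h'⟩ := h.closed
    (P := fun x => ∃ hx : x ∈ Tᶜ, (G.induce Tᶜ).Reachable ⟨a, ha⟩ ⟨x, hx⟩)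
    (fun x y (hxy : (G.isolate T).Adj x y) ⟨hx, hax⟩ => ⟨hxy.2.2, hax.trans
      (Adj.reachable (G := G.induce Tᶜ) (u := ⟨x, hx⟩) (v := ⟨y, hxy.2.2⟩) hxy.1)⟩)
    ⟨ha, .refl _⟩
  exact h'

lemma numComponentsOff_le_one_iff [Finite V] : G.numComponentsOff T ≤ 1 ↔
    ∀ a ∉ T, ∀ b ∉ T, (G.isolate T).Reachable a b := by
  rw [numComponentsOff, Finite.card_le_one_iff_subsingleton]
  constructor
  · intro h a ha b hb
    rw [← reachable_induce_compl_iff ha hb, ← ConnectedComponent.eq]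
    exact Subsingleton.elim _ _
  · intro h
    refine ⟨fun C C' => ?_⟩
    induction C using ConnectedComponent.ind with | _ x
    induction C' using ConnectedComponent.ind with | _ y
    exact ConnectedComponent.eq.2 ((reachable_induce_compl_iff x.2 y.2).2 (h _ x.2 _ y.2))

lemma numComponentsOff_pos [Finite V] {a : V} (ha : a ∉ T) : 0 < G.numComponentsOff T := by
  have : Nonempty (G.induce Tᶜ).ConnectedComponent := ⟨connectedComponentMk _ ⟨a, ha⟩⟩
  exact Nat.card_pos

lemma isCutpoint_iff [Finite V] (hG : G.Preconnected) {v : V} :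
    G.IsCutpoint v ↔ ∃ a b, a ≠ v ∧ b ≠ v ∧ ¬ (G.isolate {v}).Reachable a b := by
  have h1 : G.numComponentsOff ∅ = 1 := by
    refine le_antisymm (numComponentsOff_le_one_iff.2 fun a _ b _ => ?_)
      (numComponentsOff_pos (a := v) (by simp))
    exact (hG a b).mono fun x y h => ⟨h, by simp, by simp⟩
  rw [IsCutpoint, IsCutset]
  simp only [Set.mem_singleton_iff, forall_eq, sdiff_self, Set.bot_eq_empty, h1]
  rw [← not_le, numComponentsOff_le_one_iff]
  push Not
  simp only [Set.mem_singleton_iff]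
  constructor
  · rintro ⟨a, ha, b, hb, h⟩
    exact ⟨a, b, ha, hb, h⟩
  · rintro ⟨a, b, ha, hb, h⟩
    exact ⟨a, ha, b, hb, h⟩

/-- The cutpoints of a block with whiskers that lie in the block are the whiskered vertices. -/
theorem isCutpoint_addWhiskers_iff [Finite V] [Nontrivial V] {B : SimpleGraph V} {W : Set V}
    (hB : B.IsBlockGraph) {v : V} : (B.addWhiskers W).IsCutpoint (Sum.inl v) ↔ v ∈ W := by
  have hpre : (B.addWhiskers W).Preconnected := fun x y =>
    (preconnected_addWhiskers_isolate_empty hB.1.preconnected x y).mono isolate_le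
  rw [isCutpoint_iff hpre]
  constructor
  · rintro ⟨x, y, hx, hy, hxy⟩
    by_contra hv
    have hB' := hB.2 v
    rw [isCutpoint_iff hB.1.preconnected] at hB'
    push Not at hB'
    have hS : (Sum.inl ⁻¹' ({Sum.inl v} : Set (V ⊕ W)) : Set V) = {v} := by
      ext
      simp
    have hbase : ∀ z : V ⊕ W, z ≠ Sum.inl v → whiskerBase z ≠ v ∧
        ((B.addWhiskers W).isolate {Sum.inl v}).Reachable z (Sum.inl (whiskerBase z)) := by
      rintro (z | f) hz
      · exact ⟨fun h => hz (congrArg _ h), .refl _⟩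
      · have hf : f.1 ≠ v := fun h => hv (h ▸ f.2)
        exact ⟨hf, Adj.reachable (G := (B.addWhiskers W).isolate _)
          ⟨addWhiskers_adj_inr_inl.2 rfl, by simp, by simpa [whiskerBase] using hf⟩⟩
    refine hxy ((hbase x hx).2.trans (Reachable.trans ?_ (hbase y hy).2.symm))
    apply Reachable.isolate_addWhiskers
    rw [hS]
    exact hB' _ _ (hbase x hx).1 (hbase y hy).1
  · intro hv
    obtain ⟨v', hv'⟩ := exists_ne v
    refine ⟨Sum.inr ⟨v, hv⟩, Sum.inl v', by simp, by simpa using hv', fun h => ?_⟩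
    have := h.closed (P := fun x => x = Sum.inr ⟨v, hv⟩) ?_ rfl
    · simp at this
    · rintro x y hxy rfl
      rcases y with y | y
      · have := addWhiskers_adj_inr_inl.1 hxy.1
        exact absurd (by rw [this]; rfl) hxy.2.2
      · exact absurd hxy.1 addWhiskers_adj_inr_inr

/-! ### Short cycles -/

namespace Subgraph

variable {D : G.Subgraph} {n : ℕ}

lemma IsCycleGraph.exists_param (h : D.IsCycleGraph n) : ∃ p : Fin n → V, Function.Injective p ∧
    D.verts = Set.range p ∧ ∀ i j, D.Adj (p i) (p j) ↔ (cycleGraph n).Adj i j := by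
  obtain ⟨-, ⟨e⟩⟩ := h
  refine ⟨fun i => (e.symm i : V), Subtype.val_injective.comp e.symm.injective, ?_, fun i j => ?_⟩
  · ext v
    refine ⟨fun hv => ⟨e ⟨v, hv⟩, by simp⟩, ?_⟩
    rintro ⟨i, rfl⟩
    exact (e.symm i).2
  · rw [← e.symm.map_adj_iff]
    rfl

lemma IsCycleGraph.ncard_verts (h : D.IsCycleGraph n) : D.verts.ncard = n := by
  obtain ⟨p, hp, hv, -⟩ := h.exists_param
  rw [hv, ← Set.image_univ, Set.ncard_image_of_injective _ hp, Set.ncard_univ, Nat.card_fin]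

lemma IsCycleGraph.ncard_edgeSet (h : D.IsCycleGraph n) :
    D.edgeSet.ncard = (cycleGraph n).edgeSet.ncard := by
  obtain ⟨p, hp, hv, ha⟩ := h.exists_param
  rw [← Set.ncard_image_of_injective _ (Sym2.map.injective hp)]
  congr 1
  ext e
  induction e with | _ a b
  constructor
  · intro hab
    rw [Subgraph.mem_edgeSet] at hab
    have h1 := D.edge_vert hab
    have h2 := D.edge_vert hab.symm
    rw [hv] at h1 h2
    obtain ⟨i, rfl⟩ := h1
    obtain ⟨j, rfl⟩ := h2
    exact ⟨s(i, j), (ha i j).1 hab, rfl⟩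
  · rintro ⟨e, he, hab⟩
    induction e with | _ i j
    rw [← hab]
    exact (ha i j).2 he

lemma IsCycleGraph.ncard_edgeSet_of_three (h : D.IsCycleGraph 3) : D.edgeSet.ncard = 3 := by
  rw [h.ncard_edgeSet, Set.ncard_eq_toFinset_card']
  decide

lemma IsCycleGraph.ncard_edgeSet_of_four (h : D.IsCycleGraph 4) : D.edgeSet.ncard = 4 := by
  rw [h.ncard_edgeSet, Set.ncard_eq_toFinset_card']
  decide

lemma IsCycleGraph.adj_of_three (h : D.IsCycleGraph 3) {a b : V} (ha : a ∈ D.verts)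
    (hb : b ∈ D.verts) (hab : a ≠ b) : D.Adj a b := by
  obtain ⟨p, hp, hv, hadj⟩ := h.exists_param
  rw [hv] at ha hb
  obtain ⟨i, rfl⟩ := ha
  obtain ⟨j, rfl⟩ := hb
  rw [hadj, cycleGraph_three_eq_top]
  exact fun h => hab (congrArg p h)

/-- The third vertex of a triangle. -/
lemma IsCycleGraph.exists_third (h : D.IsCycleGraph 3) {a b : V} (ha : a ∈ D.verts)
    (hb : b ∈ D.verts) (hab : a ≠ b) : ∃ c, c ≠ a ∧ c ≠ b ∧ D.verts = {a, b, c} := by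
  have h1 := h.ncard_verts
  obtain ⟨x, y, z, hxy, hxz, hyz, hD⟩ := Set.ncard_eq_three.1 h1
  rw [hD] at ha hb ⊢
  simp only [Set.mem_insert_iff, Set.mem_singleton_iff] at ha hb
  rcases ha with rfl | rfl | rfl <;> rcases hb with rfl | rfl | rfl <;> try exact absurd rfl hab
  · exact ⟨z, hxz.symm, hyz.symm, rfl⟩
  · exact ⟨y, hxy.symm, hyz, by rw [Set.pair_comm]⟩
  · exact ⟨z, hyz.symm, hxz.symm, by rw [Set.insert_comm]⟩
  · exact ⟨x, hxy, hxz, by ext; simp; tauto⟩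
  · exact ⟨y, hyz, hxy.symm, by ext; simp; tauto⟩
  · exact ⟨x, hxz, hxy, by ext; simp; tauto⟩

lemma IsCycleGraph.not_adj_of_four (h : D.IsCycleGraph 4) {a b c : V} (hab : D.Adj a b)
    (hbc : D.Adj b c) : ¬ D.Adj a c := by
  obtain ⟨p, hp, hv, hadj⟩ := h.exists_param
  have h1 := D.edge_vert hab
  have h2 := D.edge_vert hbc
  have h3 := D.edge_vert hbc.symm
  rw [hv] at h1 h2 h3
  obtain ⟨i, rfl⟩ := h1
  obtain ⟨j, rfl⟩ := h2
  obtain ⟨k, rfl⟩ := h3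
  rw [hadj] at hab hbc ⊢
  revert i j k
  decide

lemma IsCycleGraph.exists_adj_ne_of_four (h : D.IsCycleGraph 4) {a b : V} (ha : a ∈ D.verts) :
    ∃ c, c ≠ b ∧ D.Adj a c := by
  obtain ⟨p, hp, hv, hadj⟩ := h.exists_param
  rw [hv] at ha
  obtain ⟨i, rfl⟩ := ha
  have : ∃ j k, j ≠ k ∧ (cycleGraph 4).Adj i j ∧ (cycleGraph 4).Adj i k := by
    revert i
    decide
  obtain ⟨j, k, hjk, hj, hk⟩ := this
  by_cases hb : p j = b
  · exact ⟨p k, fun h => hjk (hp (hb.trans h.symm)), (hadj i k).2 hk⟩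
  · exact ⟨p j, hb, (hadj i j).2 hj⟩

end Subgraph

/-! ### The chain -/

namespace IsChainSetup

variable {B : SimpleGraph V} {W : Set V} {r : ℕ} {D : ℕ → B.Subgraph} {w u : ℕ → V}

lemma exists_mem_verts (h : B.IsChainSetup W r D w u) (v : V) :
    ∃ i, 1 ≤ i ∧ i ≤ r ∧ v ∈ (D i).verts := by
  have h1 : v ∈ (⨆ i ∈ Set.Icc 1 r, D i).verts := by
    rw [h.chain.union_eq]
    trivial
  simp only [Subgraph.verts_iSup, Set.mem_iUnion, Set.mem_Icc] at h1
  obtain ⟨i, ⟨hi, hi'⟩, hv⟩ := h1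
  exact ⟨i, hi, hi', hv⟩

lemma exists_adj (h : B.IsChainSetup W r D w u) {a b : V} (hab : B.Adj a b) :
    ∃ i, 1 ≤ i ∧ i ≤ r ∧ (D i).Adj a b := by
  have h1 : (⨆ i ∈ Set.Icc 1 r, D i).Adj a b := by
    rw [h.chain.union_eq]
    exact hab
  simp only [Subgraph.iSup_adj, Set.mem_Icc] at h1
  obtain ⟨i, ⟨hi, hi'⟩, hv⟩ := h1
  exact ⟨i, hi, hi', hv⟩

lemma ncard_verts_eq (h : B.IsChainSetup W r D w u) {i : ℕ} (hi : 1 ≤ i) (hir : i ≤ r) :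
    (D i).verts.ncard = (D i).edgeSet.ncard := by
  rcases h.three_or_four i hi hir with h' | h'
  · rw [h'.ncard_verts, h'.ncard_edgeSet_of_three]
  · rw [h'.ncard_verts, h'.ncard_edgeSet_of_four]

lemma three_le_ncard_verts (h : B.IsChainSetup W r D w u) {i : ℕ} (hi : 1 ≤ i) (hir : i ≤ r) :
    3 ≤ (D i).verts.ncard := by
  rcases h.three_or_four i hi hir with h' | h' <;> rw [h'.ncard_verts]
  norm_num

lemma nontrivial (h : B.IsChainSetup W r D w u) : Nontrivial V := by
  have h1 := h.three_le_ncard_verts le_rfl h.chain.one_le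
  obtain ⟨a, b, _, _, hab⟩ := Set.one_lt_ncard_iff (Set.finite_of_ncard_pos (by omega))
    |>.1 (show 1 < (D 1).verts.ncard by omega)
  exact ⟨a, b, hab⟩

lemma isCutpoint_iff [Finite V] (h : B.IsChainSetup W r D w u) {v : V} :
    (B.addWhiskers W).IsCutpoint (Sum.inl v) ↔ v ∈ W :=
  have := h.nontrivial
  isCutpoint_addWhiskers_iff h.chain.block

lemma gate_adj (h : B.IsChainSetup W r D w u) {i : ℕ} (hi : 1 ≤ i) (hir : i + 1 ≤ r) :
    (D i).Adj (w i) (u i) ∧ (D (i + 1)).Adj (w i) (u i) := by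
  have h1 : s(w i, u i) ∈ (D i).edgeSet ∩ (D (i + 1)).edgeSet := by
    rw [(h.inter_eq i hi hir).1]
    rfl
  exact h1

lemma w_mem [Finite V] (h : B.IsChainSetup W r D w u) {i : ℕ} (hi : 1 ≤ i) (hir : i + 1 ≤ r) :
    w i ∈ W :=
  h.isCutpoint_iff.1 (h.inter_eq i hi hir).2.1

lemma u_notMem [Finite V] (h : B.IsChainSetup W r D w u) {i : ℕ} (hi : 1 ≤ i)
    (hir : i + 1 ≤ r) : u i ∉ W :=
  fun h' => (h.inter_eq i hi hir).2.2 (h.isCutpoint_iff.2 h')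

/-- The chain conditions control only common edges; common vertices are controlled by the cycle
rank. Each cycle has as many vertices as edges and shares one edge with its predecessors, so rank r
makes the vertex overlaps add up to 2(r - 1). Each is at least 2, hence exactly 2. -/
lemma inter_verts_eq [Finite V] (h : B.IsChainSetup W r D w u) {k : ℕ} (hk : 1 ≤ k)
    (hkr : k + 1 ≤ r) : (⋃ i ∈ Set.Icc 1 k, (D i).verts) ∩ (D (k + 1)).verts = {w k, u k} := by
  set L : ℕ → Set V := fun k => ⋃ i ∈ Set.Icc 1 k, (D i).verts with hL
  set E : ℕ → Set (Sym2 V) := fun k => ⋃ i ∈ Set.Icc 1 k, (D i).edgeSet with hE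
  have hLs : ∀ k, L (k + 1) = L k ∪ (D (k + 1)).verts := fun k => by
    rw [hL]
    simp only
    rw [← Order.succ_eq_add_one, ← Set.insert_Icc_right_eq_Icc_succ (by simp), Set.biUnion_insert,
      Set.union_comm]
  have hEs : ∀ k, E (k + 1) = E k ∪ (D (k + 1)).edgeSet := fun k => by
    rw [hE]
    simp only
    rw [← Order.succ_eq_add_one, ← Set.insert_Icc_right_eq_Icc_succ (by simp), Set.biUnion_insert,
      Set.union_comm]
  have hEi : ∀ k, 1 ≤ k → k + 1 ≤ r → (E k ∩ (D (k + 1)).edgeSet).ncard = 1 := by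
    intro k hk hkr
    rw [Set.ncard_eq_one]
    refine ⟨s(w k, u k), ?_⟩
    rw [← (h.inter_eq k hk hkr).1]
    ext e
    simp only [hE, Set.mem_inter_iff, Set.mem_iUnion, Set.mem_Icc]
    constructor
    · rintro ⟨⟨i, ⟨hi, hik⟩, he⟩, he'⟩
      rcases hik.lt_or_eq with hlt | rfl
      · have := h.chain.nonconsecutive i (k + 1) hi (by omega) hkr
        exact (Set.disjoint_left.1 (Set.disjoint_iff_inter_eq_empty.2 this) he he').elim
      · exact ⟨he, he'⟩
    · rintro ⟨he, he'⟩
      exact ⟨⟨k, ⟨hk, le_rfl⟩, he⟩, he'⟩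
  have hpair : ∀ k, 1 ≤ k → k + 1 ≤ r → {w k, u k} ⊆ L k ∩ (D (k + 1)).verts := by
    intro k hk hkr
    have hg := h.gate_adj hk hkr
    have hsub : (D k).verts ⊆ L k := Set.subset_biUnion_of_mem (u := fun i => (D i).verts)
      (⟨hk, le_rfl⟩ : k ∈ Set.Icc 1 k)
    refine Set.insert_subset ⟨hsub ((D k).edge_vert hg.1), (D _).edge_vert hg.2⟩
      (Set.singleton_subset_iff.2 ⟨hsub ((D k).edge_vert hg.1.symm), (D _).edge_vert hg.2.symm⟩)
  have hne : ∀ k, 1 ≤ k → k + 1 ≤ r → ({w k, u k} : Set V).ncard = 2 := fun k hk hkr =>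
    Set.ncard_pair (h.gate_adj hk hkr).1.ne
  have hcount : ∀ k, k + 1 ≤ r → (L (k + 1)).ncard +
      ∑ j ∈ Finset.range k, (L (j + 1) ∩ (D (j + 2)).verts).ncard = (E (k + 1)).ncard + k := by
    intro k
    induction k with
    | zero =>
      intro hr
      simp only [hL, hE, zero_add, Set.Icc_self, Set.biUnion_singleton, Finset.range_zero,
        Finset.sum_empty, add_zero]
      exact h.ncard_verts_eq le_rfl hr
    | succ k ih =>
      intro hr
      have h1 := ih (by omega)
      have h2 := Set.ncard_union_add_ncard_inter (L (k + 1)) (D (k + 2)).verts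
      have h3 := Set.ncard_union_add_ncard_inter (E (k + 1)) (D (k + 2)).edgeSet
      have h4 := h.ncard_verts_eq (i := k + 2) (by omega) hr
      rw [← hLs] at h2
      rw [← hEs, hEi (k + 1) (by omega) hr] at h3
      rw [Finset.sum_range_succ]
      change (L (k + 1 + 1)).ncard + _ = (E (k + 1 + 1)).ncard + _
      omega
  obtain ⟨s, rfl⟩ : ∃ s, r = s + 1 := ⟨r - 1, by omega⟩
  have hLr : L (s + 1) = Set.univ := by
    refine Set.eq_univ_of_forall fun v => ?_
    obtain ⟨i, hi, hi', hv⟩ := h.exists_mem_verts v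
    exact Set.mem_biUnion (⟨hi, hi'⟩ : i ∈ Set.Icc 1 (s + 1)) hv
  have hEr : E (s + 1) = B.edgeSet := by
    refine Set.Subset.antisymm (Set.iUnion₂_subset fun i _ => (D i).edgeSet_subset) fun e he => ?_
    induction e with | _ a b
    obtain ⟨i, hi, hi', hv⟩ := h.exists_adj he
    exact Set.mem_biUnion (⟨hi, hi'⟩ : i ∈ Set.Icc 1 (s + 1)) hv
  have hc := hcount s le_rfl
  have hrank := h.chain.cycleRank_eq
  rw [hLr, hEr, Set.ncard_univ] at hc
  rw [SimpleGraph.cycleRank] at hrank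
  have hsum : ∑ j ∈ Finset.range s, 2 =
      ∑ j ∈ Finset.range s, (L (j + 1) ∩ (D (j + 2)).verts).ncard := by
    rw [Finset.sum_const, Finset.card_range, smul_eq_mul]
    push_cast at hrank
    omega
  have hle : ∀ j ∈ Finset.range s, 2 ≤ (L (j + 1) ∩ (D (j + 2)).verts).ncard := by
    intro j hj
    have := Finset.mem_range.1 hj
    exact (hne (j + 1) (by omega) (by omega)).symm.le.trans
      (Set.ncard_le_ncard (hpair (j + 1) (by omega) (by omega)) (Set.toFinite _))
  have heq := (Finset.sum_eq_sum_iff_of_le hle).1 hsum (k - 1) (Finset.mem_range.2 (by omega))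
  obtain ⟨k, rfl⟩ : ∃ k', k = k' + 1 := ⟨k - 1, by omega⟩
  refine (Set.eq_of_subset_of_ncard_le (hpair _ hk hkr) ?_ (Set.toFinite _)).symm
  rw [hne _ hk hkr]
  exact heq.ge

/-- A vertex common to two cycles of the chain lies on every gate between them. -/
theorem eq_or_eq_of_mem [Finite V] (h : B.IsChainSetup W r D w u) {i j k : ℕ} (hi : 1 ≤ i)
    (hij : i ≤ j) (hjk : j < k) (hkr : k ≤ r) {x : V} (hxi : x ∈ (D i).verts)
    (hxk : x ∈ (D k).verts) : x = w j ∨ x = u j := by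
  induction k, hjk using Nat.le_induction with
  | base =>
    have : x ∈ (⋃ i ∈ Set.Icc 1 j, (D i).verts) ∩ (D (j + 1)).verts :=
      ⟨Set.mem_biUnion (⟨hi, hij⟩ : i ∈ Set.Icc 1 j) hxi, hxk⟩
    rw [h.inter_verts_eq (hi.trans hij) hkr] at this
    exact this
  | succ k hjk ih =>
    have hjk' : j < k := hjk
    refine ih (by omega) ?_
    -- An earlier vertex of D_{k+1} is on gate k, hence in D_k, and the induction descends.
    have hk : x ∈ (⋃ i ∈ Set.Icc 1 k, (D i).verts) ∩ (D (k + 1)).verts :=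
      ⟨Set.mem_biUnion (⟨hi, by omega⟩ : i ∈ Set.Icc 1 k) hxi, hxk⟩
    rw [h.inter_verts_eq (by omega) hkr] at hk
    have hg := (h.gate_adj (i := k) (by omega) hkr).1
    rcases hk with rfl | hk
    · exact (D k).edge_vert hg
    · rw [Set.mem_singleton_iff.1 hk]
      exact (D k).edge_vert hg.symm

end IsChainSetup

end SimpleGraph

/-! ### Link paths -/

namespace SimpleGraph

variable {V : Type*}

/-- A vertex `v` has a link path if its neighbours lie on a path with at most four vertices, whose
interior vertices `x` are in `W` and such that `{v, x}` separates the two sides of `x` on the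
path. -/
def HasLinkPath (B : SimpleGraph V) (W : Set V) (v : V) : Prop :=
  ∃ (m : ℕ) (p : ℕ → V), m ≤ 3 ∧ (∀ y, B.Adj v y → ∃ k ≤ m, y = p k) ∧
    (∀ k < m, B.Adj (p k) (p (k + 1))) ∧
    ∀ i k j, i < k → k < j → j ≤ m → p k ∈ W ∧ ¬ (B.isolate {v, p k}).Reachable (p i) (p j)

section

variable {B : SimpleGraph V} {W : Set V} {v : V}

lemma hasLinkPath_of_two {a b : V} (hN : ∀ y, B.Adj v y → y = a ∨ y = b) (hab : B.Adj a b) :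
    B.HasLinkPath W v := by
  refine ⟨1, fun k => if k = 0 then a else b, by norm_num, fun y hy => ?_, fun k hk => ?_,
    fun i k j hik hkj hj => by omega⟩
  · rcases hN y hy with h | h
    · exact ⟨0, by norm_num, by simpa⟩
    · exact ⟨1, by norm_num, by simpa⟩
  · obtain rfl : k = 0 := by omega
    simpa

lemma hasLinkPath_of_three {a x b : V} (hN : ∀ y, B.Adj v y → y = a ∨ y = x ∨ y = b)
    (hax : B.Adj a x) (hxb : B.Adj x b) (hx : x ∈ W)
    (hsep : ¬ (B.isolate {v, x}).Reachable a b) : B.HasLinkPath W v := by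
  refine ⟨2, fun k => if k = 0 then a else if k = 1 then x else b, by norm_num, fun y hy => ?_,
    fun k hk => ?_, fun i k j hik hkj hj => ?_⟩
  · rcases hN y hy with h | h | h
    · exact ⟨0, by norm_num, by simpa⟩
    · exact ⟨1, by norm_num, by simpa⟩
    · exact ⟨2, by norm_num, by simpa⟩
  · interval_cases k <;> simpa
  · obtain rfl : i = 0 := by omega
    obtain rfl : k = 1 := by omega
    obtain rfl : j = 2 := by omega
    simpa using ⟨hx, hsep⟩

lemma hasLinkPath_of_four {a x y b : V}
    (hN : ∀ z, B.Adj v z → z = a ∨ z = x ∨ z = y ∨ z = b)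
    (hax : B.Adj a x) (hxy : B.Adj x y) (hyb : B.Adj y b) (hx : x ∈ W) (hy : y ∈ W)
    (h1 : ¬ (B.isolate {v, x}).Reachable a y) (h2 : ¬ (B.isolate {v, x}).Reachable a b)
    (h3 : ¬ (B.isolate {v, y}).Reachable a b) (h4 : ¬ (B.isolate {v, y}).Reachable x b) :
    B.HasLinkPath W v := by
  refine ⟨3, fun k => if k = 0 then a else if k = 1 then x else if k = 2 then y else b,
    le_rfl, fun z hz => ?_, fun k hk => ?_, fun i k j hik hkj hj => ?_⟩
  · rcases hN z hz with h | h | h | h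
    · exact ⟨0, by norm_num, by simpa⟩
    · exact ⟨1, by norm_num, by simpa⟩
    · exact ⟨2, by norm_num, by simpa⟩
    · exact ⟨3, by norm_num, by simpa⟩
  · interval_cases k <;> simpa
  · interval_cases j <;> interval_cases k <;> interval_cases i <;> simp_all

/-- If a and b are not joined off T, some path vertex between them is in T, hence in T ∩ W, and with
v it already separates them. Their path distance is then at least two, so on at most four vertices
each other one is next to a or b. -/
lemma HasLinkPath.separates (h : B.HasLinkPath W v) {T : Set V} (hv : v ∈ T) {a b : V}
    (ha : a ∉ T) (hb : b ∉ T) (hva : B.Adj v a) (hvb : B.Adj v b)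
    (hab : ¬ (B.isolate T).Reachable a b) :
    ¬ (B.isolate (insert v (T ∩ W))).Reachable a b ∧
      ∀ c, B.Adj v c → c = a ∨ c = b ∨ B.Adj a c ∨ B.Adj b c := by
  obtain ⟨m, p, hm, hN, hp, hsep⟩ := h
  obtain ⟨i, hi, rfl⟩ := hN a hva
  obtain ⟨j, hj, rfl⟩ := hN b hvb
  have hex : ∀ i j, i ≤ j → j ≤ m → p i ∉ T → p j ∉ T → ¬ (B.isolate T).Reachable (p i) (p j) →
      ∃ k, i < k ∧ k < j ∧ p k ∈ T := by
    intro i j hij hj hi' hj' hr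
    by_contra! hcon
    have hT : ∀ k, i ≤ k → k ≤ j → p k ∉ T := fun k hk hk' => by
      rcases hk.eq_or_lt with rfl | hk
      · exact hi'
      rcases hk'.eq_or_lt with rfl | hk'
      · exact hj'
      exact hcon k hk hk'
    have hreach : ∀ k, i ≤ k → k ≤ j → (B.isolate T).Reachable (p i) (p k) := by
      intro k hk
      induction k, hk using Nat.le_induction with
      | base => exact fun _ => .refl _
      | succ k hk ih => exact fun hk' => (ih (by omega)).trans (Adj.reachable (G := B.isolate T)
          ⟨hp k (by omega), hT k hk (by omega), hT (k + 1) (by omega) hk'⟩)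
    exact hr (hreach j hij le_rfl)
  have hmain : ∀ i j, i ≤ j → j ≤ m → p i ∉ T → p j ∉ T → ¬ (B.isolate T).Reachable (p i) (p j) →
      i + 2 ≤ j ∧ ¬ (B.isolate (insert v (T ∩ W))).Reachable (p i) (p j) := by
    intro i j hij hj hi' hj' hr
    obtain ⟨k, hik, hkj, hk⟩ := hex i j hij hj hi' hj' hr
    obtain ⟨hkW, hks⟩ := hsep i k j hik hkj hj
    refine ⟨by omega, fun h => hks (h.mono (isolate_anti ?_))⟩
    rintro x (rfl | rfl)
    · exact Set.mem_insert _ _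
    · exact Set.mem_insert_of_mem _ ⟨hk, hkW⟩
  have hcov : ∀ i j, i + 2 ≤ j → j ≤ m → ∀ c, B.Adj v c →
      c = p i ∨ c = p j ∨ B.Adj (p i) c ∨ B.Adj (p j) c := by
    intro i j hij hj c hc
    obtain ⟨l, hl, rfl⟩ := hN c hc
    have hcases : l = i ∨ l = j ∨ l = i + 1 ∨ i = l + 1 ∨ l = j + 1 ∨ j = l + 1 := by omega
    rcases hcases with rfl | rfl | rfl | rfl | rfl | rfl
    · exact Or.inl rfl
    · exact Or.inr (Or.inl rfl)
    · exact Or.inr (Or.inr (Or.inl (hp i (by omega))))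
    · exact Or.inr (Or.inr (Or.inl (hp l (by omega)).symm))
    · exact Or.inr (Or.inr (Or.inr (hp j (by omega))))
    · exact Or.inr (Or.inr (Or.inr (hp l (by omega)).symm))
  rcases le_total i j with hij | hij
  · obtain ⟨h1, h2⟩ := hmain i j hij hj ha hb hab
    exact ⟨h2, hcov i j h1 hj⟩
  · obtain ⟨h1, h2⟩ := hmain j i hij hi hb ha fun h => hab h.symm
    refine ⟨fun h => h2 h.symm, fun c hc => ?_⟩
    rcases hcov j i h1 hi c hc with h | h | h | h <;> simp [h]

/-- Two sets which cover the edges and meet only in `{x, y}` are separated by `{x, y}`. -/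
lemma not_reachable_of_separation {A C : Set V} {x y a b : V}
    (hedge : ∀ p q, B.Adj p q → (p ∈ A ∧ q ∈ A) ∨ (p ∈ C ∧ q ∈ C))
    (hAC : ∀ p ∈ A, p ∈ C → p = x ∨ p = y) (ha : a ∈ A) (hb : b ∈ C) (hab : a ≠ b) :
    ¬ (B.isolate {x, y}).Reachable a b := by
  intro h
  have hbxy : b ∉ ({x, y} : Set V) := fun h' => hab (eq_of_reachable_isolate h.symm h').symm
  have := h.closed (P := fun z => z ∈ A) (fun p q hpq hp => ?_) ha
  · exact hbxy (hAC b this hb)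
  · exact (hedge p q hpq.1).elim (fun h => h.2) fun h => absurd (hAC p hp h.1) hpq.2.1

/-! ### Ladder squares -/

/-- A four-cycle `w₀ w₁ u₁ u₀` with `w₀, w₁ ∈ W` and `u₀, u₁ ∉ W`. -/
structure IsLadderSquare (W : Set V) (D : B.Subgraph) (w₀ w₁ u₀ u₁ : V) : Prop where
  verts : D.verts = {w₀, w₁, u₀, u₁}
  adj_w : D.Adj w₀ w₁
  adj_u : D.Adj u₀ u₁
  adj₀ : D.Adj w₀ u₀
  adj₁ : D.Adj w₁ u₁
  not_adj : ¬ D.Adj w₀ u₁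
  not_adj' : ¬ D.Adj w₁ u₀
  w₀_mem : w₀ ∈ W
  w₁_mem : w₁ ∈ W
  u₀_notMem : u₀ ∉ W
  u₁_notMem : u₁ ∉ W

variable {D : B.Subgraph} {w₀ w₁ u₀ u₁ : V}

lemma IsLadderSquare.symm (h : IsLadderSquare W D w₀ w₁ u₀ u₁) :
    IsLadderSquare W D w₁ w₀ u₁ u₀ where
  verts := by rw [h.verts, Set.insert_comm, Set.pair_comm u₀]
  adj_w := h.adj_w.symm
  adj_u := h.adj_u.symm
  adj₀ := h.adj₁
  adj₁ := h.adj₀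
  not_adj := h.not_adj'
  not_adj' := h.not_adj
  w₀_mem := h.w₁_mem
  w₁_mem := h.w₀_mem
  u₀_notMem := h.u₁_notMem
  u₁_notMem := h.u₀_notMem

lemma Subgraph.IsCycleGraph.isLadderSquare (h : D.IsCycleGraph 4)
    (hv : D.verts = {w₀, w₁, u₀, u₁}) (hw : D.Adj w₀ w₁) (hu : D.Adj u₀ u₁) (h1 : D.Adj w₁ u₁)
    (hw₀ : w₀ ∈ W) (hw₁ : w₁ ∈ W) (hu₀ : u₀ ∉ W) (hu₁ : u₁ ∉ W) :
    IsLadderSquare W D w₀ w₁ u₀ u₁ where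
  verts := hv
  adj_w := hw
  adj_u := hu
  adj₀ := by
    obtain ⟨c, hc, hadj⟩ := h.exists_adj_ne_of_four (b := w₁) (D.edge_vert hw)
    have hcv := D.edge_vert hadj.symm
    rw [hv] at hcv
    rcases hcv with rfl | rfl | rfl | rfl
    · exact absurd rfl hadj.ne
    · exact absurd rfl hc
    · exact hadj
    · exact absurd hadj (h.not_adj_of_four hw h1)
  adj₁ := h1
  not_adj := h.not_adj_of_four hw h1
  not_adj' := h.not_adj_of_four h1 hu.symm
  w₀_mem := hw₀
  w₁_mem := hw₁
  u₀_notMem := hu₀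
  u₁_notMem := hu₁

lemma IsLadderSquare.w₁_ne_u₀ (h : IsLadderSquare W D w₀ w₁ u₀ u₁) : w₁ ≠ u₀ :=
  fun h' => h.u₀_notMem (h' ▸ h.w₁_mem)

end

namespace IsChainSetup

variable {B : SimpleGraph V} {W : Set V} {r : ℕ} {D : ℕ → B.Subgraph} {w u : ℕ → V}

/-- Otherwise D_i and D_{i+2} would share an edge. -/
lemma gate_ne (h : B.IsChainSetup W r D w u) {i : ℕ} (hi : 1 ≤ i) (hir : i + 2 ≤ r)
    (hw : w i = w (i + 1)) : u i ≠ u (i + 1) := by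
  intro hu
  have h1 := (h.gate_adj hi (by omega)).1
  have h2 := (h.gate_adj (i := i + 1) (by omega) hir).2
  rw [← hw, ← hu] at h2
  have h3 := h.chain.nonconsecutive i (i + 2) hi (by omega) hir
  exact Set.disjoint_left.1 (Set.disjoint_iff_inter_eq_empty.2 h3)
    (show s(w i, u i) ∈ (D i).edgeSet from h1) h2

/-- The square is oriented along the chain, with {w₀, u₀} the gate from the previous cycle and {w₁,
u₁} the gate to the next one, where these exist. -/
theorem exists_isLadderSquare [Finite V] (h : B.IsChainSetup W r D w u) {i : ℕ} (hi : 1 ≤ i)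
    (hir : i ≤ r) (h4 : (D i).IsCycleGraph 4) : ∃ w₀ w₁ u₀ u₁, IsLadderSquare W (D i) w₀ w₁ u₀ u₁ ∧
      (i + 1 ≤ r → w₁ = w i ∧ u₁ = u i) ∧ (∀ j, i = j + 1 → 1 ≤ j → w₀ = w j ∧ u₀ = u j) := by
  have hne4 := h4.ncard_verts
  rcases hi.eq_or_lt with rfl | hi1
  · obtain ⟨hv, hw, hu, hw0, hw1, hu0, hu1⟩ := h.first_four h4
    rw [h.isCutpoint_iff] at hw0 hw1 hu0 hu1
    rcases hir.eq_or_lt with rfl | hir1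
    · obtain ⟨c, hc, hadj⟩ := h4.exists_adj_ne_of_four (b := w 1) ((D 1).edge_vert hw)
      have hcv := (D 1).edge_vert hadj.symm
      rw [hv] at hcv
      rcases hcv with rfl | rfl | rfl | rfl
      · exact absurd rfl hadj.ne
      · exact absurd rfl hc
      · refine ⟨w 0, w 1, u 0, u 1, (h4.isLadderSquare (w₀ := w 1) (w₁ := w 0) (u₀ := u 1)
          (u₁ := u 0) ?_ hw.symm hu.symm hadj hw1 hw0 hu1 hu0).symm, by omega, by omega⟩
        rw [hv, Set.insert_comm, Set.pair_comm (u 0)]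
      · refine ⟨w 0, w 1, u 1, u 0, (h4.isLadderSquare (w₀ := w 1) (w₁ := w 0) (u₀ := u 0)
          (u₁ := u 1) ?_ hw.symm hu hadj hw1 hw0 hu0 hu1).symm, by omega, by omega⟩
        rw [hv, Set.insert_comm]
    · exact ⟨w 0, w 1, u 0, u 1, h4.isLadderSquare hv hw hu (h.gate_adj le_rfl hir1).1
        hw0 hw1 hu0 hu1, fun _ => ⟨rfl, rfl⟩, by omega⟩
  · obtain ⟨j, rfl⟩ : ∃ j, i = j + 1 := ⟨i - 1, by omega⟩
    have hg := (h.gate_adj (i := j) (by omega) hir).2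
    have hwj := h.w_mem (i := j) (by omega) hir
    have huj := h.u_notMem (i := j) (by omega) hir
    rcases hir.eq_or_lt with rfl | hir1
    · obtain ⟨hv, hw, hu, hw0, hw1, hu0, hu1⟩ := h.last_four h4
      rw [h.isCutpoint_iff] at hw0 hw1 hu0 hu1
      simp only [Nat.add_sub_cancel] at hv hw hu hw0 hw1 hu0 hu1
      refine ⟨w j, w (j + 1), u j, u (j + 1), (h4.isLadderSquare (w₀ := w (j + 1)) (w₁ := w j)
        (u₀ := u (j + 1)) (u₁ := u j) ?_ hw.symm hu.symm hg hw1 hw0 hu1 hu0).symm, by omega, ?_⟩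
      · rw [hv, Set.insert_comm, Set.pair_comm (u j)]
      · rintro j' hj' -
        obtain rfl : j = j' := by omega
        exact ⟨rfl, rfl⟩
    · have hg' := (h.gate_adj (i := j + 1) (by omega) hir1).1
      have hwj' := h.w_mem (i := j + 1) (by omega) hir1
      have huj' := h.u_notMem (i := j + 1) (by omega) hir1
      obtain ⟨hw, hu⟩ := h.next_label j (by omega) (by omega)
      -- Gates with a common w would close a triangle with u_j and u_{j+1} inside the 4-cycle.
      have hwne : w j ≠ w (j + 1) := by
        intro hwe
        have hu' := hu.resolve_right (h.gate_ne (by omega) (by omega) hwe)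
        rw [hwe] at hg
        exact h4.not_adj_of_four hg hu' hg'
      have hw' := hw.resolve_right hwne
      have hune : u j ≠ u (j + 1) := by
        intro hue
        rw [hue] at hg
        exact h4.not_adj_of_four hw' hg' hg
      have hu' := hu.resolve_right hune
      have h1 : w j ≠ u j := hg.ne
      have h2 : w j ≠ u (j + 1) := fun h' => huj' (h' ▸ hwj)
      have h3 : w (j + 1) ≠ u j := fun h' => huj (h' ▸ hwj')
      have h5 : w (j + 1) ≠ u (j + 1) := hg'.ne
      have hv : (D (j + 1)).verts = {w j, w (j + 1), u j, u (j + 1)} := by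
        refine (Set.eq_of_subset_of_ncard_le ?_ ?_ (Set.toFinite _)).symm
        · rintro x (rfl | rfl | rfl | rfl)
          · exact (D _).edge_vert hg
          · exact (D _).edge_vert hg'
          · exact (D _).edge_vert hg.symm
          · exact (D _).edge_vert hg'.symm
        · rw [hne4, Set.ncard_insert_of_notMem, Set.ncard_insert_of_notMem, Set.ncard_pair hune] <;>
            simp [h1, h2, h3, h5, hwne]
      refine ⟨w j, w (j + 1), u j, u (j + 1), h4.isLadderSquare hv hw' hu' hg' hwj hwj' huj huj',
        fun _ => ⟨rfl, rfl⟩, ?_⟩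
      rintro j' hj' -
      obtain rfl : j = j' := by omega
      exact ⟨rfl, rfl⟩

/-! ### Separations of the chain -/

/-- The cycles up to j and those after j cover all edges and share only the gate. -/
lemma not_reachable_gate [Finite V] (h : B.IsChainSetup W r D w u) {i j k : ℕ} (hi : 1 ≤ i)
    (hij : i ≤ j)
    (hjk : j < k) (hkr : k ≤ r) {a b : V} (ha : a ∈ (D i).verts) (hb : b ∈ (D k).verts)
    (hab : a ≠ b) : ¬ (B.isolate {u j, w j}).Reachable a b := by
  refine not_reachable_of_separation (A := {x | ∃ i, 1 ≤ i ∧ i ≤ j ∧ x ∈ (D i).verts})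
    (C := {x | ∃ k, j < k ∧ k ≤ r ∧ x ∈ (D k).verts}) (fun p q hpq => ?_) ?_ ⟨i, hi, hij, ha⟩
    ⟨k, hjk, hkr, hb⟩ hab
  · obtain ⟨l, hl, hlr, hadj⟩ := h.exists_adj hpq
    rcases le_or_gt l j with hlj | hlj
    · exact Or.inl ⟨⟨l, hl, hlj, (D l).edge_vert hadj⟩, ⟨l, hl, hlj, (D l).edge_vert hadj.symm⟩⟩
    · exact Or.inr ⟨⟨l, hlj, hlr, (D l).edge_vert hadj⟩, ⟨l, hlj, hlr, (D l).edge_vert hadj.symm⟩⟩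
  · rintro p ⟨i', hi', hij', hp⟩ ⟨k', hjk', hkr', hp'⟩
    exact (h.eq_or_eq_of_mem hi' hij' hjk' hkr' hp hp').symm

/-- Each edge of the square meets exactly one of the opposite corners u₀ and w₁. One side takes the
edges at u₀ and the P-cycles, the other those at w₁ and the Q-cycles; only the other diagonal is
common. Abstract P and Q let the same argument serve both directions of the chain. -/
lemma not_reachable_diagonal (h : B.IsChainSetup W r D w u) {i : ℕ} {w₀ w₁ u₀ u₁ : V}
    (hsq : IsLadderSquare W (D i) w₀ w₁ u₀ u₁) {P Q : ℕ → Prop}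
    (hPQi : ∀ j, 1 ≤ j → j ≤ r → P j ∨ Q j ∨ j = i)
    (hP : ∀ j, 1 ≤ j → j ≤ r → P j → ∀ x ∈ (D j).verts, x ∈ (D i).verts → x = w₀ ∨ x = u₀)
    (hQ : ∀ j, 1 ≤ j → j ≤ r → Q j → ∀ x ∈ (D j).verts, x ∈ (D i).verts → x = w₁ ∨ x = u₁)
    (hPQ : ∀ j k, 1 ≤ j → j ≤ r → P j → 1 ≤ k → k ≤ r → Q k → ∀ x ∈ (D j).verts,
      x ∈ (D k).verts → x ∈ (D i).verts)
    {b : V} (hb : b = w₁ ∨ ∃ k, 1 ≤ k ∧ k ≤ r ∧ Q k ∧ b ∈ (D k).verts) (hbu : u₀ ≠ b) :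
    ¬ (B.isolate {u₁, w₀}).Reachable u₀ b := by
  have hmem : ∀ x, x = w₀ ∨ x = w₁ ∨ x = u₀ ∨ x = u₁ → x ∈ (D i).verts := fun x hx => by
    rw [hsq.verts]
    exact hx
  have h1 : w₁ ≠ u₀ := hsq.w₁_ne_u₀
  have h2 : u₀ ≠ w₁ := h1.symm
  have h3 : w₀ ≠ w₁ := hsq.adj_w.ne
  have h4 : u₀ ≠ u₁ := hsq.adj_u.ne
  have h5 : w₁ ≠ w₀ := h3.symm
  refine not_reachable_of_separation
    (A := {x | (∃ j, 1 ≤ j ∧ j ≤ r ∧ P j ∧ x ∈ (D j).verts) ∨ x = w₀ ∨ x = u₀ ∨ x = u₁})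
    (C := {x | (∃ k, 1 ≤ k ∧ k ≤ r ∧ Q k ∧ x ∈ (D k).verts) ∨ x = w₁ ∨ x = u₁ ∨ x = w₀})
    (fun p q hpq => ?_) ?_ (Or.inr (Or.inr (Or.inl rfl))) ?_ hbu
  · obtain ⟨l, hl, hlr, hadj⟩ := h.exists_adj hpq
    have hp := (D l).edge_vert hadj
    have hq := (D l).edge_vert hadj.symm
    rcases hPQi l hl hlr with hPl | hQl | rfl
    · exact Or.inl ⟨Or.inl ⟨l, hl, hlr, hPl, hp⟩, Or.inl ⟨l, hl, hlr, hPl, hq⟩⟩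
    · exact Or.inr ⟨Or.inl ⟨l, hl, hlr, hQl, hp⟩, Or.inl ⟨l, hl, hlr, hQl, hq⟩⟩
    · rw [hsq.verts] at hp hq
      have hn1 := hsq.not_adj'
      have hn2 : ¬ (D l).Adj u₀ w₁ := fun h' => hn1 h'.symm
      rcases hp with rfl | rfl | rfl | rfl <;> rcases hq with rfl | rfl | rfl | rfl <;>
        first
        | exact absurd hadj hn1
        | exact absurd hadj hn2
        | exact Or.inl ⟨Or.inr (by simp), Or.inr (by simp)⟩
        | exact Or.inr ⟨Or.inr (by simp), Or.inr (by simp)⟩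
  · rintro p (⟨j, hj, hjr, hPj, hp⟩ | hp) (⟨k, hk, hkr, hQk, hp'⟩ | hp')
    · have hpi := hPQ j k hj hjr hPj hk hkr hQk p hp hp'
      have h6 := hP j hj hjr hPj p hp hpi
      have h7 := hQ k hk hkr hQk p hp' hpi
      rcases h6 with rfl | rfl
      · exact Or.inr rfl
      · exact Or.inl (h7.resolve_left h2)
    · rcases hp' with rfl | rfl | rfl
      · exact (hP j hj hjr hPj p hp (hmem _ (by simp))).elim Or.inr fun h' => absurd h' h1
      · exact Or.inl rfl
      · exact Or.inr rfl
    · rcases hp with rfl | rfl | rfl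
      · exact Or.inr rfl
      · exact Or.inl ((hQ k hk hkr hQk p hp' (hmem _ (by simp))).resolve_left h2)
      · exact Or.inl rfl
    · rcases hp with rfl | rfl | rfl
      · exact Or.inr rfl
      · rcases hp' with h' | h' | h'
        · exact absurd h' h2
        · exact Or.inl h'
        · exact Or.inr h'
      · exact Or.inl rfl
  · rcases hb with rfl | hb
    · exact Or.inr (Or.inl rfl)
    · exact Or.inl hb

lemma not_reachable_diagonal_right [Finite V] (h : B.IsChainSetup W r D w u) {i : ℕ} (hi : 1 ≤ i)
    (hir : i ≤ r) {w₀ w₁ u₀ u₁ : V} (hsq : IsLadderSquare W (D i) w₀ w₁ u₀ u₁)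
    (h1 : i + 1 ≤ r → w₁ = w i ∧ u₁ = u i)
    (h0 : ∀ j, i = j + 1 → 1 ≤ j → w₀ = w j ∧ u₀ = u j) {b : V}
    (hb : b = w₁ ∨ ∃ k, i < k ∧ k ≤ r ∧ b ∈ (D k).verts) (hbu : u₀ ≠ b) :
    ¬ (B.isolate {u₁, w₀}).Reachable u₀ b := by
  refine h.not_reachable_diagonal hsq (P := fun j => j < i) (Q := fun j => i < j)
    (fun j _ _ => by omega) (fun j hj hjr hji x hx hxi => ?_) (fun j hj hjr hji x hx hxi => ?_)
    (fun j k hj hjr hji hk hkr hik x hx hx' => ?_) ?_ hbu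
  · obtain ⟨i', rfl⟩ : ∃ i', i = i' + 1 := ⟨i - 1, by omega⟩
    obtain ⟨rfl, rfl⟩ := h0 i' rfl (by omega)
    exact h.eq_or_eq_of_mem hj (by omega) (by omega) hir hx hxi
  · obtain ⟨rfl, rfl⟩ := h1 (by omega)
    exact h.eq_or_eq_of_mem hi le_rfl hji hjr hxi hx
  · have hg := (h.gate_adj hi (by omega)).1
    rcases h.eq_or_eq_of_mem hj hji.le hik hkr hx hx' with rfl | rfl
    · exact (D i).edge_vert hg
    · exact (D i).edge_vert hg.symm
  · exact hb.imp id fun ⟨k, hk, hkr, hbk⟩ => ⟨k, by omega, hkr, hk, hbk⟩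

lemma not_reachable_diagonal_left [Finite V] (h : B.IsChainSetup W r D w u) {i : ℕ} (hi : 1 ≤ i)
    (hir : i ≤ r) {w₀ w₁ u₀ u₁ : V} (hsq : IsLadderSquare W (D i) w₀ w₁ u₀ u₁)
    (h1 : i + 1 ≤ r → w₁ = w i ∧ u₁ = u i)
    (h0 : ∀ j, i = j + 1 → 1 ≤ j → w₀ = w j ∧ u₀ = u j) {b : V}
    (hb : b = w₀ ∨ ∃ k, 1 ≤ k ∧ k < i ∧ b ∈ (D k).verts) (hbu : u₁ ≠ b) :
    ¬ (B.isolate {u₀, w₁}).Reachable b u₁ := by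
  intro hr
  refine h.not_reachable_diagonal hsq.symm (P := fun j => i < j) (Q := fun j => j < i)
    (fun j _ _ => by omega) (fun j hj hjr hji x hx hxi => ?_) (fun j hj hjr hji x hx hxi => ?_)
    (fun j k hj hjr hji hk hkr hik x hx hx' => ?_) ?_ hbu hr.symm
  · obtain ⟨rfl, rfl⟩ := h1 (by omega)
    exact h.eq_or_eq_of_mem hi le_rfl hji hjr hxi hx
  · obtain ⟨i', rfl⟩ : ∃ i', i = i' + 1 := ⟨i - 1, by omega⟩
    obtain ⟨rfl, rfl⟩ := h0 i' rfl (by omega)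
    exact h.eq_or_eq_of_mem hj (by omega) (by omega) hir hx hxi
  · have hg := (h.gate_adj hi (by omega)).1
    rcases h.eq_or_eq_of_mem hk (le_of_lt hik) hji hjr hx' hx with rfl | rfl
    · exact (D i).edge_vert hg
    · exact (D i).edge_vert hg.symm
  · exact hb.imp id fun ⟨k, hk, hki, hbk⟩ => ⟨k, hk, by omega, hki, hbk⟩

end IsChainSetup

end SimpleGraph

/-! ### Link paths in the chain -/

namespace SimpleGraph

variable {V : Type*}

lemma Subgraph.IsCycleGraph.exists_pair {G : SimpleGraph V} {D : G.Subgraph}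
    (h : D.IsCycleGraph 3) {a : V} (ha : a ∈ D.verts) :
    ∃ b c, b ≠ a ∧ c ≠ a ∧ b ≠ c ∧ D.verts = {a, b, c} := by
  obtain ⟨b, hb, hba⟩ := Set.exists_ne_of_one_lt_ncard
    (show 1 < D.verts.ncard by rw [h.ncard_verts]; norm_num) a
  obtain ⟨c, hca, hcb, hD⟩ := h.exists_third ha hb hba.symm
  exact ⟨b, c, hba, hca, hcb.symm, hD⟩

namespace IsChainSetup

variable {B : SimpleGraph V} {W : Set V} {r : ℕ} {D : ℕ → B.Subgraph} {w u : ℕ → V}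

lemma ncard_le_neighborSet [Finite V] {s : Set V} {v : V} (hs : ∀ x ∈ s, B.Adj v x) :
    s.ncard ≤ ((B.addWhiskers W).neighborSet (Sum.inl v)).ncard := by
  rw [← Set.ncard_image_of_injective s (Sum.inl_injective (β := W))]
  refine Set.ncard_le_ncard ?_ (Set.toFinite _)
  rintro _ ⟨x, hx, rfl⟩
  exact addWhiskers_adj_inl_inl.2 (hs x hx)

lemma ncard_le_four [Finite V] (h : B.IsChainSetup W r D w u) {s : Set V} {v : V} (hv : v ∉ W)
    (hs : ∀ x ∈ s, B.Adj v x) : s.ncard ≤ 4 := by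
  by_contra hcon
  exact hv (h.isCutpoint_iff.1 (h.high_degree v
    (Or.inl (le_trans (by omega) (ncard_le_neighborSet (W := W) hs)))))

lemma ncard_le_three [Finite V] (h : B.IsChainSetup W r D w u) {s : Set V} {v : V} (hv : v ∉ W)
    (hs : ∀ x ∈ s, B.Adj v x) {i : ℕ} (hi : 1 ≤ i) (hir : i ≤ r) (h4 : (D i).IsCycleGraph 4)
    (hvi : v ∈ (D i).verts) : s.ncard ≤ 3 := by
  by_contra hcon
  exact hv (h.isCutpoint_iff.1 (h.high_degree v
    (Or.inr ⟨le_trans (by omega) (ncard_le_neighborSet (W := W) hs), i, hi, hir, h4, hvi⟩)))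

lemma eq_u_of_mem [Finite V] (h : B.IsChainSetup W r D w u) {v : V} (hv : v ∉ W) {i j k : ℕ}
    (hi : 1 ≤ i)
    (hij : i ≤ j) (hjk : j < k) (hkr : k ≤ r) (hvi : v ∈ (D i).verts) (hvk : v ∈ (D k).verts) :
    v = u j :=
  (h.eq_or_eq_of_mem hi hij hjk hkr hvi hvk).resolve_left fun h' =>
    hv (h' ▸ h.w_mem (hi.trans hij) (by omega))

/-- The vertex has to be u_j on every gate in between, so the cycles through it are consecutive. -/
lemma mem_of_mem [Finite V] (h : B.IsChainSetup W r D w u) {v : V} (hv : v ∉ W) {i j k : ℕ}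
    (hi : 1 ≤ i)
    (hij : i ≤ j) (hjk : j < k) (hkr : k ≤ r) (hvi : v ∈ (D i).verts) (hvk : v ∈ (D k).verts) :
    v ∈ (D (j + 1)).verts := by
  rw [h.eq_u_of_mem hv hi hij hjk hkr hvi hvk]
  exact (D (j + 1)).edge_vert (h.gate_adj (hi.trans hij) (by omega)).2.symm

lemma isCycleGraph_three_of (h : B.IsChainSetup W r D w u) {i : ℕ} (hi : 1 ≤ i) (hir : i ≤ r)
    (h4 : ¬ (D i).IsCycleGraph 4) : (D i).IsCycleGraph 3 :=
  (h.three_or_four i hi hir).resolve_right h4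

/-- A vertex lying on a single cycle of the chain has a link path. -/
lemma hasLinkPath_of_one [Finite V] (h : B.IsChainSetup W r D w u) {v : V} (hv : v ∉ W) {p : ℕ}
    (hp : 1 ≤ p) (hpr : p ≤ r) (hvp : v ∈ (D p).verts)
    (hfan : ∀ k, 1 ≤ k → k ≤ r → v ∈ (D k).verts → k = p) : B.HasLinkPath W v := by
  have hN : ∀ y, B.Adj v y → y ∈ (D p).verts ∧ (D p).Adj v y := fun y hy => by
    obtain ⟨k, hk, hkr, hadj⟩ := h.exists_adj hy
    obtain rfl := hfan k hk hkr ((D k).edge_vert hadj)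
    exact ⟨(D k).edge_vert hadj.symm, hadj⟩
  by_cases h4 : (D p).IsCycleGraph 4
  · obtain ⟨w₀, w₁, u₀, u₁, hsq, h1, h0⟩ := h.exists_isLadderSquare hp hpr h4
    rw [hsq.verts] at hvp
    rcases hvp with rfl | rfl | rfl | rfl
    · exact absurd hsq.w₀_mem hv
    · exact absurd hsq.w₁_mem hv
    -- The path goes around the square through the corner opposite v, which is not itself a
    -- neighbour of v.
    · refine hasLinkPath_of_three (a := w₀) (x := w₁) (b := u₁) (fun y hy => ?_)
        hsq.adj_w.adj_sub hsq.adj₁.adj_sub hsq.w₁_mem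
        (h.not_reachable_diagonal_left hp hpr hsq h1 h0 (Or.inl rfl)
          fun h' => hsq.u₁_notMem (h' ▸ hsq.w₀_mem))
      have hy' := (hN y hy).1
      rw [hsq.verts] at hy'
      rcases hy' with rfl | rfl | rfl | rfl
      · exact Or.inl rfl
      · exact Or.inr (Or.inl rfl)
      · exact absurd rfl hy.ne
      · exact Or.inr (Or.inr rfl)
    · refine hasLinkPath_of_three (a := u₀) (x := w₀) (b := w₁) (fun y hy => ?_)
        hsq.adj₀.adj_sub.symm hsq.adj_w.adj_sub hsq.w₀_mem
        (h.not_reachable_diagonal_right hp hpr hsq h1 h0 (Or.inl rfl) hsq.w₁_ne_u₀.symm)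
      have hy' := (hN y hy).1
      rw [hsq.verts] at hy'
      rcases hy' with rfl | rfl | rfl | rfl
      · exact Or.inr (Or.inl rfl)
      · exact Or.inr (Or.inr rfl)
      · exact Or.inl rfl
      · exact absurd rfl hy.ne
  · have h3 := h.isCycleGraph_three_of hp hpr h4
    obtain ⟨b, c, hb, hc, hbc, hD⟩ := h3.exists_pair hvp
    refine hasLinkPath_of_two (a := b) (b := c) (fun y hy => ?_)
      (h3.adj_of_three (by simp [hD]) (by simp [hD]) hbc).adj_sub
    have hy' := (hN y hy).1
    rw [hD] at hy'
    exact hy'.resolve_left hy.ne'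

/-- A vertex lying on exactly two cycles of the chain has a link path. -/
lemma hasLinkPath_of_two_cycles [Finite V] (h : B.IsChainSetup W r D w u) {p : ℕ}
    (hp : 1 ≤ p) (hpr : p + 1 ≤ r)
    (hfan : ∀ k, 1 ≤ k → k ≤ r → u p ∈ (D k).verts → k = p ∨ k = p + 1) :
    B.HasLinkPath W (u p) := by
  have hN : ∀ y, B.Adj (u p) y → y ∈ (D p).verts ∨ y ∈ (D (p + 1)).verts := fun y hy => by
    obtain ⟨k, hk, hkr, hadj⟩ := h.exists_adj hy
    rcases hfan k hk hkr ((D k).edge_vert hadj) with rfl | rfl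
    · exact Or.inl ((D k).edge_vert hadj.symm)
    · exact Or.inr ((D _).edge_vert hadj.symm)
  obtain ⟨hg1, hg2⟩ := h.gate_adj hp hpr
  have hw1 := (D p).edge_vert hg1
  have hu1 := (D p).edge_vert hg1.symm
  have hw2 := (D (p + 1)).edge_vert hg2
  have hu2 := (D (p + 1)).edge_vert hg2.symm
  have hwW := h.w_mem hp hpr
  have huW := h.u_notMem hp hpr
  have hsep : ∀ {a b : V}, a ∈ (D p).verts → b ∈ (D (p + 1)).verts → a ≠ b →
      ¬ (B.isolate {u p, w p}).Reachable a b := fun ha hb hab =>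
    h.not_reachable_gate hp le_rfl (Nat.lt_succ_self p) hpr ha hb hab
  have hboth : ∀ {a : V}, a ∈ (D p).verts → a ∈ (D (p + 1)).verts → a = w p ∨ a = u p :=
    fun ha hb => h.eq_or_eq_of_mem hp le_rfl (Nat.lt_succ_self p) hpr ha hb
  by_cases h4 : (D p).IsCycleGraph 4
  · have h3' := h.four_then_three p hp hpr h4
    obtain ⟨w₀, w₁, u₀, u₁, hsq, h1, h0⟩ := h.exists_isLadderSquare hp (by omega) h4
    obtain ⟨rfl, rfl⟩ := h1 hpr
    obtain ⟨c, hcw, hcu, hD⟩ := h3'.exists_third hw2 hu2 hg2.ne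
    have hc : c ∈ (D (p + 1)).verts := by simp [hD]
    have hv : ∀ x, x ∈ (D p).verts ↔ x = w₀ ∨ x = w p ∨ x = u₀ ∨ x = u p := fun x => by
      rw [hsq.verts]
      rfl
    have hcp : c ∉ (D p).verts := fun h' => (hboth h' hc).elim hcw hcu
    have hu₀ : u₀ ∈ (D p).verts := by simp [hv]
    have hw₀ : w₀ ∈ (D p).verts := by simp [hv]
    refine hasLinkPath_of_four (a := u₀) (x := w₀) (y := w p) (b := c) (fun y hy => ?_)
      hsq.adj₀.adj_sub.symm hsq.adj_w.adj_sub (h3'.adj_of_three hw2 hc hcw.symm).adj_sub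
      hsq.w₀_mem hwW
      (h.not_reachable_diagonal_right hp (by omega) hsq h1 h0 (Or.inl rfl) hsq.w₁_ne_u₀.symm)
      (h.not_reachable_diagonal_right hp (by omega) hsq h1 h0
        (Or.inr ⟨p + 1, by omega, hpr, hc⟩) fun h' => hcp (h' ▸ hu₀))
      (hsep hu₀ hc fun h' => hcp (h' ▸ hu₀)) (hsep hw₀ hc fun h' => hcp (h' ▸ hw₀))
    rcases hN y hy with hy' | hy'
    · rw [hv] at hy'
      have := hy.ne'
      tauto
    · rw [hD] at hy'
      rcases hy' with rfl | rfl | rfl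
      · simp
      · exact absurd rfl hy.ne
      · simp
  have h3 := h.isCycleGraph_three_of hp (by omega) h4
  obtain ⟨c, hcw, hcu, hD⟩ := h3.exists_third hw1 hu1 hg1.ne
  have hc : c ∈ (D p).verts := by simp [hD]
  have hcp : c ∉ (D (p + 1)).verts := fun h' => (hboth hc h').elim hcw hcu
  have hcwadj : B.Adj c (w p) := (h3.adj_of_three hc hw1 hcw).adj_sub
  by_cases h4' : (D (p + 1)).IsCycleGraph 4
  · obtain ⟨w₀, w₁, u₀, u₁, hsq, h1, h0⟩ := h.exists_isLadderSquare (by omega) hpr h4'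
    obtain ⟨rfl, rfl⟩ := h0 p rfl hp
    have hv : ∀ x, x ∈ (D (p + 1)).verts ↔ x = w p ∨ x = w₁ ∨ x = u p ∨ x = u₁ := fun x => by
      rw [hsq.verts]
      rfl
    have hu₁ : u₁ ∈ (D (p + 1)).verts := by simp [hv]
    have hw₁ : w₁ ∈ (D (p + 1)).verts := by simp [hv]
    refine hasLinkPath_of_four (a := c) (x := w p) (y := w₁) (b := u₁) (fun y hy => ?_)
      hcwadj hsq.adj_w.adj_sub hsq.adj₁.adj_sub hwW hsq.w₁_mem
      (hsep hc hw₁ fun h' => hcp (h' ▸ hw₁)) (hsep hc hu₁ fun h' => hcp (h' ▸ hu₁))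
      (h.not_reachable_diagonal_left (by omega) hpr hsq h1 h0
        (Or.inr ⟨p, hp, by omega, hc⟩) fun h' => hcp (h' ▸ hu₁))
      (h.not_reachable_diagonal_left (by omega) hpr hsq h1 h0 (Or.inl rfl)
        fun h' => hsq.u₁_notMem (h' ▸ hwW))
    rcases hN y hy with hy' | hy'
    · rw [hD] at hy'
      rcases hy' with rfl | rfl | rfl
      · simp
      · exact absurd rfl hy.ne
      · simp
    · rw [hv] at hy'
      have := hy.ne'
      tauto
  have h3' := h.isCycleGraph_three_of (by omega) hpr h4'
  obtain ⟨c', hcw', hcu', hD'⟩ := h3'.exists_third hw2 hu2 hg2.ne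
  have hc' : c' ∈ (D (p + 1)).verts := by simp [hD']
  refine hasLinkPath_of_three (a := c) (x := w p) (b := c') (fun y hy => ?_) hcwadj
    (h3'.adj_of_three hw2 hc' hcw'.symm).adj_sub hwW (hsep hc hc' fun h' => hcp (h' ▸ hc'))
  rcases hN y hy with hy' | hy'
  · rw [hD] at hy'
    rcases hy' with rfl | rfl | rfl
    · simp
    · exact absurd rfl hy.ne
    · simp
  · rw [hD'] at hy'
    rcases hy' with rfl | rfl | rfl
    · simp
    · exact absurd rfl hy.ne
    · simp

/-- A vertex of a cycle has a neighbour in it different from a given vertex. -/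
lemma exists_adj_ne (h : B.IsChainSetup W r D w u) {i : ℕ} (hi : 1 ≤ i) (hir : i ≤ r) {a b : V}
    (ha : a ∈ (D i).verts) : ∃ c, c ≠ b ∧ (D i).Adj a c := by
  rcases h.three_or_four i hi hir with h3 | h4
  · obtain ⟨x, y, hx, hy, hxy, hD⟩ := h3.exists_pair ha
    by_cases hb : x = b
    · exact ⟨y, fun h' => hxy (hb.trans h'.symm), h3.adj_of_three ha (by simp [hD]) hy.symm⟩
    · exact ⟨x, hb, h3.adj_of_three ha (by simp [hD]) hx.symm⟩
  · exact h4.exists_adj_ne_of_four ha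

/-- A vertex outside `W` lying on at least three cycles of the chain has a link path. -/
lemma hasLinkPath_of_three_cycles [Finite V] (h : B.IsChainSetup W r D w u) {v : V} {p : ℕ}
    (hv : v ∉ W)
    (hp : 1 ≤ p) (hpr : p + 2 ≤ r) (hvp : v ∈ (D p).verts) (hvp2 : v ∈ (D (p + 2)).verts)
    (hmin : ∀ k, 1 ≤ k → k ≤ r → v ∈ (D k).verts → p ≤ k) : B.HasLinkPath W v := by
  have hv1 : v = u p := h.eq_u_of_mem hv hp le_rfl (by omega) hpr hvp hvp2
  have hv2 : v = u (p + 1) := h.eq_u_of_mem hv hp (by omega) (by omega) hpr hvp hvp2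
  obtain ⟨hg1, hg2⟩ := h.gate_adj hp (by omega)
  obtain ⟨hg3, hg4⟩ := h.gate_adj (i := p + 1) (by omega) hpr
  rw [← hv1] at hg1 hg2
  rw [← hv2] at hg3 hg4
  have hww : w p ≠ w (p + 1) := fun h' => h.gate_ne hp hpr h' (hv1.symm.trans hv2)
  have hw1W := h.w_mem hp (by omega)
  have hw2W := h.w_mem (i := p + 1) (by omega) hpr
  have hvp1 := (D (p + 1)).edge_vert hg2.symm
  obtain ⟨c, hcw, hcadj⟩ := h.exists_adj_ne hp (by omega) (b := w p) hvp
  obtain ⟨c', hcw', hcadj'⟩ := h.exists_adj_ne (i := p + 2) (by omega) hpr (b := w (p + 1)) hvp2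
  have hc := (D p).edge_vert hcadj.symm
  have hc' := (D (p + 2)).edge_vert hcadj'.symm
  have hcne : ∀ k x, p < k → k ≤ r → x ∈ (D k).verts → c ≠ x := by
    rintro k x hk hkr hx rfl
    rcases h.eq_or_eq_of_mem hp le_rfl hk hkr hc hx with h' | h'
    · exact hcw h'
    · exact hcadj.ne (hv1.trans h'.symm)
  have hcne' : ∀ k x, 1 ≤ k → k < p + 2 → x ∈ (D k).verts → x ≠ c' := by
    rintro k x hk hkp hx rfl
    rcases h.eq_or_eq_of_mem hk (j := p + 1) (by omega) (by omega) hpr hx hc' with h' | h'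
    · exact hcw' h'
    · exact hcadj'.ne (hv2.trans h'.symm)
  have hw1m := (D (p + 1)).edge_vert hg2
  have hw2m := (D (p + 1)).edge_vert hg3
  have hcw2 : c ≠ w (p + 1) := hcne (p + 1) _ (by omega) (by omega) hw2m
  have hcc' : c ≠ c' := hcne (p + 2) _ (by omega) (by omega) hc'
  have hw1c' : w p ≠ c' := hcne' (p + 1) _ (by omega) (by omega) hw1m
  have hw2c' : w (p + 1) ≠ c' := hcne' (p + 1) _ (by omega) (by omega) hw2m
  -- The four neighbours c, w_p, w_{p+1}, c' violate the degree condition if v ∉ W is on a square.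
  have hnot4 : ∀ i, 1 ≤ i → i ≤ r → v ∈ (D i).verts → (D i).IsCycleGraph 3 := by
    intro i hi hir hvi
    refine h.isCycleGraph_three_of hi hir fun h4 => ?_
    have h1 : ({c, w p, w (p + 1), c'} : Set V).ncard = 4 := by
      rw [Set.ncard_insert_of_notMem, Set.ncard_insert_of_notMem, Set.ncard_pair hw2c'] <;>
        simp [hcw, hcw2, hcc', hww, hw1c']
    have h2 := h.ncard_le_three hv (s := {c, w p, w (p + 1), c'}) (by
      rintro x (rfl | rfl | rfl | rfl)
      · exact hcadj.adj_sub
      · exact hg1.adj_sub.symm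
      · exact hg3.adj_sub.symm
      · exact hcadj'.adj_sub) hi hir h4 hvi
    omega
  -- A fourth cycle would contribute a fifth neighbour d, again forcing v ∈ W.
  have hmax : ∀ k, 1 ≤ k → k ≤ r → v ∈ (D k).verts → k ≤ p + 2 := by
    intro k hk hkr hvk
    by_contra hcon
    have hv3 : v = u (p + 2) := h.eq_u_of_mem hv hp (by omega) (by omega) hkr hvp hvk
    obtain ⟨hg5, hg6⟩ := h.gate_adj (i := p + 2) (by omega) (by omega)
    rw [← hv3] at hg5 hg6
    have hvp3 := (D (p + 3)).edge_vert hg6.symm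
    obtain ⟨d, hdw, hdadj⟩ := h.exists_adj_ne (i := p + 3) (by omega) (by omega)
      (b := w (p + 2)) hvp3
    have hd := (D (p + 3)).edge_vert hdadj.symm
    have hdne : ∀ k x, 1 ≤ k → k < p + 3 → x ∈ (D k).verts → x ≠ d := by
      rintro k x hk hkp hx rfl
      rcases h.eq_or_eq_of_mem hk (j := p + 2) (by omega) (by omega) (by omega) hx hd with h' | h'
      · exact hdw h'
      · exact hdadj.ne (hv3.trans h'.symm)
    have hw3m := (D (p + 2)).edge_vert hg5
    have hw3m' := (D (p + 3)).edge_vert hg6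
    have hww2 : w (p + 1) ≠ w (p + 2) := fun h' =>
      h.gate_ne (i := p + 1) (by omega) (by omega) h' (hv2.symm.trans hv3)
    have hww3 : w p ≠ w (p + 2) := by
      intro h'
      rw [← h'] at hw3m'
      rcases h.eq_or_eq_of_mem (j := p + 1) (k := p + 3) (by omega) (by omega) (by omega)
        (by omega) hw1m hw3m' with h'' | h''
      · exact hww h''
      · exact hg1.ne (h''.trans hv2.symm)
    have h1 : ({c, w p, w (p + 1), w (p + 2), d} : Set V).ncard = 5 := by
      rw [Set.ncard_insert_of_notMem, Set.ncard_insert_of_notMem, Set.ncard_insert_of_notMem,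
        Set.ncard_pair (hdne (p + 2) _ (by omega) (by omega) hw3m)] <;>
        simp [hcw, hcw2, hww, hww2, hww3, hcne (p + 2) _ (by omega) (by omega) hw3m,
          hdne p _ hp (by omega) hc, hdne (p + 1) _ (by omega) (by omega) hw1m,
          hdne (p + 1) _ (by omega) (by omega) hw2m]
    have h2 := h.ncard_le_four hv (s := {c, w p, w (p + 1), w (p + 2), d}) (by
      rintro x (rfl | rfl | rfl | rfl | rfl)
      · exact hcadj.adj_sub
      · exact hg1.adj_sub.symm
      · exact hg3.adj_sub.symm
      · exact hg5.adj_sub.symm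
      · exact hdadj.adj_sub)
    omega
  have h3a := hnot4 p hp (by omega) hvp
  have h3b := hnot4 (p + 1) (by omega) (by omega) hvp1
  have h3c := hnot4 (p + 2) (by omega) hpr hvp2
  have triangle : ∀ {i : ℕ} {x y : V}, (D i).IsCycleGraph 3 → (D i).Adj v x → (D i).Adj v y →
      x ≠ y → ∀ z ∈ (D i).verts, z ≠ v → z = x ∨ z = y := by
    intro i x y h3 hx hy hxy z hz hzv
    obtain ⟨t, -, -, hD⟩ := h3.exists_third ((D i).edge_vert hx) ((D i).edge_vert hx.symm) hx.ne
    have hy' := (D i).edge_vert hy.symm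
    rw [hD] at hz hy'
    rcases hy' with rfl | rfl | rfl
    · exact absurd rfl hy.ne
    · exact absurd rfl hxy
    · exact hz.resolve_left hzv
  refine hasLinkPath_of_four (a := c) (x := w p) (y := w (p + 1)) (b := c') (fun y hy => ?_)
    (h3a.adj_of_three hc ((D p).edge_vert hg1) hcw).adj_sub
    (h3b.adj_of_three hw1m hw2m hww).adj_sub
    (h3c.adj_of_three ((D (p + 2)).edge_vert hg4) hc' hw2c').adj_sub hw1W hw2W ?_ ?_ ?_ ?_
  · obtain ⟨k, hk, hkr, hadj⟩ := h.exists_adj hy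
    have hvk := (D k).edge_vert hadj
    have hyk := (D k).edge_vert hadj.symm
    have hk1 := hmin k hk hkr hvk
    have hk2 := hmax k hk hkr hvk
    obtain rfl | rfl | rfl : k = p ∨ k = p + 1 ∨ k = p + 2 := by omega
    · have := triangle h3a hcadj hg1.symm hcw y hyk hy.ne'
      tauto
    · have := triangle h3b hg2.symm hg3.symm hww y hyk hy.ne'
      tauto
    · have := triangle h3c hg4.symm hcadj' hw2c' y hyk hy.ne'
      tauto
  · rw [hv1]
    exact h.not_reachable_gate hp le_rfl (k := p + 1) (by omega) (by omega) hc hw2m hcw2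
  · rw [hv1]
    exact h.not_reachable_gate hp le_rfl (k := p + 2) (by omega) (by omega) hc hc' hcc'
  · rw [hv2]
    exact h.not_reachable_gate hp (by omega) (k := p + 2) (by omega) (by omega) hc hc' hcc'
  · rw [hv2]
    exact h.not_reachable_gate (i := p + 1) (by omega) le_rfl (k := p + 2) (by omega) (by omega)
      hw1m hc' hw1c'

theorem hasLinkPath [Finite V] (h : B.IsChainSetup W r D w u) {v : V} (hv : v ∉ W) :
    B.HasLinkPath W v := by
  classical
  have hex : ∃ i, 1 ≤ i ∧ i ≤ r ∧ v ∈ (D i).verts := h.exists_mem_verts v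
  obtain ⟨p, ⟨hp, hpr, hvp⟩, hmin⟩ : ∃ p, (1 ≤ p ∧ p ≤ r ∧ v ∈ (D p).verts) ∧
      ∀ k, 1 ≤ k → k ≤ r → v ∈ (D k).verts → p ≤ k :=
    ⟨Nat.find hex, Nat.find_spec hex, fun k h1 h2 h3 => Nat.find_min' hex ⟨h1, h2, h3⟩⟩
  by_cases h1 : p + 1 ≤ r ∧ v ∈ (D (p + 1)).verts
  · by_cases h2 : p + 2 ≤ r ∧ v ∈ (D (p + 2)).verts
    · exact h.hasLinkPath_of_three_cycles hv hp h2.1 hvp h2.2 hmin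
    · have hvu : v = u p := h.eq_u_of_mem hv hp le_rfl (Nat.lt_succ_self p) h1.1 hvp h1.2
      subst hvu
      refine h.hasLinkPath_of_two_cycles hp h1.1 fun k hk hkr hvk => ?_
      have := hmin k hk hkr hvk
      by_contra hcon
      exact h2 ⟨by omega, h.mem_of_mem hv hp (j := p + 1) (by omega) (by omega) hkr hvp hvk⟩
  · refine h.hasLinkPath_of_one hv hp hpr hvp fun k hk hkr hvk => ?_
    have := hmin k hk hkr hvk
    by_contra hcon
    exact h1 ⟨by omega, h.mem_of_mem hv hp le_rfl (by omega) hkr hvp hvk⟩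

/-! ### Sets of whiskered vertices do not disconnect the chain -/

/-- Triangles are complete; in a square the edge u₀u₁ survives and each w-corner is adjacent to one
of its ends. -/
lemma reachable_of_mem_cycle [Finite V] (h : B.IsChainSetup W r D w u) {S : Set V} (hS : S ⊆ W)
    {i : ℕ}
    (hi : 1 ≤ i) (hir : i ≤ r) {a b : V} (ha : a ∈ (D i).verts) (hb : b ∈ (D i).verts)
    (haS : a ∉ S) (hbS : b ∉ S) : (B.isolate S).Reachable a b := by
  rcases h.three_or_four i hi hir with h3 | h4
  · by_cases hab : a = b
    · rw [hab]
    · exact Adj.reachable (G := B.isolate S) ⟨(h3.adj_of_three ha hb hab).adj_sub, haS, hbS⟩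
  · obtain ⟨w₀, w₁, u₀, u₁, hsq, -, -⟩ := h.exists_isLadderSquare hi hir h4
    have hu₀ : u₀ ∉ S := fun h' => hsq.u₀_notMem (hS h')
    have hu₁ : u₁ ∉ S := fun h' => hsq.u₁_notMem (hS h')
    have huu : (B.isolate S).Reachable u₁ u₀ :=
      Adj.reachable (G := B.isolate S) ⟨hsq.adj_u.adj_sub.symm, hu₁, hu₀⟩
    have key : ∀ x ∈ (D i).verts, x ∉ S → (B.isolate S).Reachable x u₀ := by
      intro x hx hxS
      rw [hsq.verts] at hx
      rcases hx with rfl | rfl | rfl | rfl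
      · exact Adj.reachable (G := B.isolate S) ⟨hsq.adj₀.adj_sub, hxS, hu₀⟩
      · exact (Adj.reachable (G := B.isolate S) ⟨hsq.adj₁.adj_sub, hxS, hu₁⟩).trans huu
      · exact .refl _
      · exact huu
    exact (key a ha haS).trans (key b hb hbS).symm

/-- Every gate keeps its vertex u_j ∉ W, through which one passes to the next cycle. -/
theorem reachable_isolate [Finite V] (h : B.IsChainSetup W r D w u) {S : Set V} (hS : S ⊆ W)
    {a b : V}
    (haS : a ∉ S) (hbS : b ∉ S) : (B.isolate S).Reachable a b := by
  have key : ∀ i j, 1 ≤ i → i ≤ j → j ≤ r → ∀ a ∈ (D i).verts, ∀ b ∈ (D j).verts, a ∉ S → b ∉ S →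
      (B.isolate S).Reachable a b := by
    intro i j hi hij
    induction j, hij using Nat.le_induction with
    | base => exact fun hir a ha b hb => h.reachable_of_mem_cycle hS hi hir ha hb
    | succ j hij ih =>
      intro hjr a ha b hb haS hbS
      have huS : u j ∉ S := fun h' => h.u_notMem (hi.trans hij) hjr (hS h')
      obtain ⟨hg1, hg2⟩ := h.gate_adj (hi.trans hij) hjr
      exact (ih (by omega) a ha (u j) ((D j).edge_vert hg1.symm) haS huS).trans
        (h.reachable_of_mem_cycle hS (by omega) hjr ((D _).edge_vert hg2.symm) hb huS hbS)
  obtain ⟨i, hi, hir, ha⟩ := h.exists_mem_verts a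
  obtain ⟨j, hj, hjr, hb⟩ := h.exists_mem_verts b
  rcases le_total i j with hij | hij
  · exact key i j hi hij hjr a ha b hb haS hbS
  · exact (key j i hj hij hir b hb a ha hbS haS).symm

end IsChainSetup

end SimpleGraph

theorem mainTheorem7 (K : Type*) [Field K] {V : Type*} [Finite V] (B : SimpleGraph V) (W : Set V)
    (r : ℕ) (D : ℕ → B.Subgraph) (w u : ℕ → V) (h : B.IsChainSetup W r D w u) :
    ((B.addWhiskers W).binomialEdgeIdeal K).IsUnmixed := by
  have := h.nontrivial
  refine SimpleGraph.isUnmixed_binomialEdgeIdeal fun T hT =>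
    SimpleGraph.card_connectedComponent_isolate_addWhiskers ?_ ?_ hT
  · exact fun S hS a ha b hb => h.reachable_isolate hS ha hb
  · exact fun T v a b hv hvT ha hb hva hvb hab =>
      (h.hasLinkPath hv).separates hvT ha hb hva hvb hab
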